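/- Two-way heterogeneity model. For nodes $1,\dots,p$ and $\theta=(\beta_0,\beta_1)\in\mathbb R^p\times\mathbb R^p$, $\beta_r=(\beta_{1,r},\dots,\beta_{p,r})$, put $\alpha_{r,i,j}=e^{\beta_{i,r}+\beta_{j,r}}$, $r=0,1$. The stationary model $P_\theta$ is the law of a sequence $X^0,X^1,X^2,\dots$ of random symmetric $0$-$1$ adjacency matrices with zero diagonal such that, for $i<j$ and $t\ge1$, $$X^t_{i,j}=I(\varepsilon^t_{i,j}=0)+X^{t-1}_{i,j}\,I(\varepsilon^t_{i,j}=1),$$ where $\varepsilon^t_{i,j}$ takes the values $0,1,-1$ with probabilities $\alpha_{0,i,j}/Z_{i,j}$, $\alpha_{1,i,j}/Z_{i,j}$, $1/Z_{i,j}$, $Z_{i,j}=1+\alpha_{0,i,j}+\alpha_{1,i,j}$, where $P(X^0_{i,j}=1)=\alpha_{0,i,j}/(1+\alpha_{0,i,j})$, and where all $X^0_{i,j}$ and $\varepsilon^t_{i,j}$ ($i<j$, $t\ge1$) are mutually independent. Given $X^0,\dots,X^n$, a method-of-moments estimator (MME) is a solution $\tilde\theta=(\tilde\beta_0,\tilde\beta_1)$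 of the decoupled moment equations, for $i=1,\dots,p$, $$\frac1n\sum_{t=1}^n\sum_{j\ne i}X^t_{i,j}-\sum_{j\neq i}\frac{e^{\tilde\beta_{i,0}+\tilde\beta_{j,0}}}{1+e^{\tilde\beta_{i,0}+\tilde\beta_{j,0}}}=0,$$ $$\sum_{t=1}^n\sum_{j\neq i}\Big\{X^t_{i,j}X^{t-1}_{i,j}-\frac{e^{\tilde\beta_{i,0}+\tilde\beta_{j,0}}}{1+e^{\tilde\beta_{i,0}+\tilde\beta_{j,0}}}\Big(1-\frac1{1+e^{\tilde\beta_{i,0}+\tilde\beta_{j,0}}+e^{\tilde\beta_{i,1}+\tilde\beta_{j,1}}}\Big)\Big\}=0 .$$ Theorem. There is an absolute constant $c>0$ such that the following holds. Consider a sequence of stationary models $\{X^t\}\sim P_{\theta^*}$ on $p\ge3$ nodes, each observed at times $0,\dots,n$ with $n\ge2$, where $n$, $p$ and $\theta^*$ vary along the sequence and $np\to\infty$. Assume that there is a constant $K$, the same along the sequence, with $\beta^*_{i,1}-\max(\beta^*_{i,0},0)<K$ for all $i$. Let $\kappa_r=\|\beta_r^*\|_\infty$, $r=0,1$. Then the moment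 equations never have more than one solution. If moreover $\kappa_0+\kappa_1\le c\log(np)$ along the sequence, then with probability tending to one the MME $\tilde\theta$ exists and is unique, and $$\|\tilde\theta-\theta^*\|_\infty=O_p\Big(e^{14\kappa_0+6\kappa_1}\sqrt{\frac{\log n\,\log p}{np}}\Big).$$ -/

import Mathlib

open MeasureTheory ProbabilityTheory Filter Topology

noncomputable section

/-- The index set of unordered pairs of distinct nodes, listed as `(i, j)` with `i < j`. -/
abbrev EdgeIdx (p : ℕ) : Type := {e : Fin p × Fin p // e.1 < e.2}

/-- Parameters of the two-way heterogeneity model: `θ 0 i` is the static parameter of node `i` and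
`θ 1 i` is its dynamic parameter. The norm is the maximum of all `2 p` absolute values, and `‖θ r‖`
is the maximum norm of the vector of the `θ r i`. -/
abbrev TWHMParam (p : ℕ) : Type := Fin 2 → Fin p → ℝ

/-- `odds θ r i j = exp (θ r i + θ r j)`. -/
def odds {p : ℕ} (θ : TWHMParam p) (r : Fin 2) (i j : Fin p) : ℝ :=
  Real.exp (θ r i + θ r j)

/-- `X` is a stationary two-way heterogeneity model with parameter `θ`, driven by the innovations
`ε`: `X t i j` is the `(i, j)` entry of the adjacency matrix at time `t = 0, 1, 2, …`; only the
innovations `ε t i j` with `1 ≤ t` and `i < j` are used. -/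
structure IsStationaryTWHM {p : ℕ} {Ω : Type*} [MeasurableSpace Ω] (μ : Measure Ω)
    (θ : TWHMParam p) (X : ℕ → Fin p → Fin p → Ω → ℤ) (ε : ℕ → Fin p → Fin p → Ω → ℤ) :
    Prop where
  binary : ∀ t i j ω, X t i j ω = 0 ∨ X t i j ω = 1
  symm : ∀ t i j ω, X t i j ω = X t j i ω
  hollow : ∀ t i ω, X t i i ω = 0
  measurable_init : ∀ i j, i < j → Measurable (X 0 i j)
  measurable_innov : ∀ t i j, 1 ≤ t → i < j → Measurable (ε t i j)
  /-- the autoregression -/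
  step : ∀ t i j ω, 1 ≤ t → i < j →
    X t i j ω = (if ε t i j ω = 0 then 1 else 0) + X (t - 1) i j ω * (if ε t i j ω = 1 then 1 else 0)
  innov_zero : ∀ t i j, 1 ≤ t → i < j →
    μ.real {ω | ε t i j ω = 0} = odds θ 0 i j / (1 + odds θ 0 i j + odds θ 1 i j)
  innov_one : ∀ t i j, 1 ≤ t → i < j →
    μ.real {ω | ε t i j ω = 1} = odds θ 1 i j / (1 + odds θ 0 i j + odds θ 1 i j)
  innov_neg_one : ∀ t i j, 1 ≤ t → i < j →
    μ.real {ω | ε t i j ω = -1} = 1 / (1 + odds θ 0 i j + odds θ 1 i j)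
  /-- the initial network has the stationary marginal distribution -/
  init : ∀ i j, i < j → μ.real {ω | X 0 i j ω = 1} = odds θ 0 i j / (1 + odds θ 0 i j)
  /-- the entries of the initial network and all innovations are mutually independent -/
  indep : iIndepFun (Sum.elim (fun e : EdgeIdx p => X 0 e.1.1 e.1.2)
    (fun q : EdgeIdx p × ℕ => ε (q.2 + 1) q.1.1.1 q.1.1.2)) μ

/-- `θ` solves the moment equations for the observed adjacency matrices `x 0, …, x n`: the first
system for the static part `θ 0`, and the second system for the dynamic part `θ 1`, in which the
solution `θ 0` of the first system is plugged in. -/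
structure IsMME {p : ℕ} (n : ℕ) (x : ℕ → Fin p → Fin p → ℤ) (θ : TWHMParam p) : Prop where
  static : ∀ i : Fin p,
    (∑ t ∈ Finset.Icc 1 n, ∑ j ∈ Finset.univ.erase i, (x t i j : ℝ)) / (n : ℝ)
      - ∑ j ∈ Finset.univ.erase i, odds θ 0 i j / (1 + odds θ 0 i j) = 0
  dynamic : ∀ i : Fin p,
    ∑ t ∈ Finset.Icc 1 n, ∑ j ∈ Finset.univ.erase i,
      ((x t i j : ℝ) * (x (t - 1) i j : ℝ)
        - odds θ 0 i j / (1 + odds θ 0 i j) * (1 - 1 / (1 + odds θ 0 i j + odds θ 1 i j))) = 0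

/-- `est` is a method-of-moments estimator: it solves the moment equations at every sample point at
which they have a solution (elsewhere its value is arbitrary). -/
def IsMMEstimator {p : ℕ} {Ω : Type*} (n : ℕ) (X : ℕ → Fin p → Fin p → Ω → ℤ)
    (est : Ω → TWHMParam p) : Prop :=
  ∀ ω, (∃ θ, IsMME n (fun t i j => X t i j ω) θ) → IsMME n (fun t i j => X t i j ω) (est ω)

/-- `Y k = O_p (r k)` as `k → ∞`, where `Y k` lives on its own probability space. -/
def IsBigOInProb {Ω : ℕ → Type*} [∀ k, MeasurableSpace (Ω k)] (μ : ∀ k, Measure (Ω k))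
    (Y : ∀ k, Ω k → ℝ) (r : ℕ → ℝ) : Prop :=
  ∀ δ : ℝ, 0 < δ → ∃ C : ℝ, 0 < C ∧
    ∀ᶠ k in atTop, μ k {ω | C * r k < |Y k ω|} ≤ ENNReal.ofReal δ

end

/-! ### Symmetric systems of pairwise equations -/

/-! Both moment systems have the form `∑ j ≠ i, f i j (b i + b j) = d i` with `f` symmetric and
increasing; in the dynamic system the static solution is frozen. Pairing the difference of two such
systems with `δ i + δ j` gives a sum of nonnegative terms, and symmetrization turns it into `2 ∑ i,
δ i * (row sum)`. This identity gives uniqueness at once (`eq_of_rowSum_eq`). With a lower bound on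
the slopes it also gives stability in the maximum norm (`abs_le_of_rowSum_le`), because the signless
Laplacian of the complete graph on at least three nodes is well conditioned. Existence near the
truth (`exists_rowSum_eq`) comes from minimizing a potential over a box: stability keeps the
minimizer off the boundary. Applied to the static system and then to the dynamic one, this yields
`exists_isMME`: if the empirical moments are within `(p - 1) * s` of their means, there is a
solution within a constant times `exp (10 κ₀ + 4 κ₁) * s`.

It remains to show that the moments concentrate. For one pair of nodes, each centred moment sum is a
martingale plus a telescoping boundary term, by the Poisson equation of the two-state chain, and
hence sub-Gaussian with proxy of order `n * exp (4 κ₁)`. The pairs in one row are independent, so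
these proxies add up over the row, and a union bound over the rows allows `s` of order `exp (2 κ₁) *
√(log p / (n p))`. By uniqueness the nearby solution is the estimator. -/

lemma sum_erase_symm_mul_add {ι : Type*} [Fintype ι] [DecidableEq ι] {g : ι → ι → ℝ}
    (hg : ∀ i j, g i j = g j i) (y : ι → ℝ) :
    ∑ i, ∑ j ∈ Finset.univ.erase i, g i j * (y i + y j)
      = 2 * ∑ i, y i * ∑ j ∈ Finset.univ.erase i, g i j := by
  have hswap : ∑ i, ∑ j ∈ Finset.univ.erase i, g i j * y j
      = ∑ i, ∑ j ∈ Finset.univ.erase i, g i j * y i := by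
    rw [Finset.sum_comm' (t' := Finset.univ) (s' := fun j => Finset.univ.erase j)
      (by intro x y; simp [eq_comm])]
    exact Finset.sum_congr rfl fun i _ => Finset.sum_congr rfl fun j _ => by rw [hg]
  simp_rw [mul_add, Finset.sum_add_distrib, hswap, Finset.mul_sum]
  rw [← Finset.sum_add_distrib]
  refine Finset.sum_congr rfl fun i _ => ?_
  rw [← Finset.sum_add_distrib]
  exact Finset.sum_congr rfl fun j _ => by ring

/-- The row sums of a symmetric array that dominates the signless Laplacian of the complete graph
control the maximum norm. -/
lemma abs_le_of_rowSum_le {p : ℕ} (hp : 3 ≤ p) {v : Fin p → Fin p → ℝ}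
    (hv : ∀ i j, v i j = v j i) {δ : Fin p → ℝ} {a s : ℝ} (ha : 0 < a) (hs : 0 ≤ s)
    (hpos : ∀ i j, i ≠ j → 0 ≤ δ i + δ j → a * (δ i + δ j) ≤ v i j)
    (hneg : ∀ i j, i ≠ j → δ i + δ j ≤ 0 → v i j ≤ a * (δ i + δ j))
    (hrow : ∀ i, δ i * ∑ j ∈ Finset.univ.erase i, v i j ≤ |δ i| * ((p - 1) * s)) (i : Fin p) :
    |δ i| ≤ 4 * s / a := by
  have hp' : (3 : ℝ) ≤ p := by exact_mod_cast hp
  set L := ∑ i, |δ i| with hL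
  set ρ := ((p : ℝ) - 1) * s with hρ
  have hL0 : 0 ≤ L := Finset.sum_nonneg fun i _ => abs_nonneg _
  have hcard : ∀ i : Fin p, ((Finset.univ.erase i).card : ℝ) = p - 1 := by
    intro i
    rw [Finset.card_erase_of_mem (Finset.mem_univ i), Finset.card_univ, Fintype.card_fin,
      Nat.cast_sub (by omega), Nat.cast_one]
  have hsumerase : ∀ i : Fin p, ∑ j ∈ Finset.univ.erase i, (δ i + δ j)
      = (p - 2) * δ i + ∑ j, δ j := by
    intro i
    rw [Finset.sum_add_distrib, Finset.sum_const, nsmul_eq_mul, hcard,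
      ← Finset.add_sum_erase _ δ (Finset.mem_univ i)]
    ring
  -- The quadratic form of the signless Laplacian is tested at `δ` itself; it equals `2a((p - 2)∑
  -- δᵢ² + (∑ δᵢ)²)`, so Cauchy–Schwarz turns this into a bound on the ℓ¹ norm `L`.
  have hquad : ∑ i, ∑ j ∈ Finset.univ.erase i, a * (δ i + δ j) * (δ i + δ j) ≤ 2 * (ρ * L) := by
    calc ∑ i, ∑ j ∈ Finset.univ.erase i, a * (δ i + δ j) * (δ i + δ j)
        ≤ ∑ i, ∑ j ∈ Finset.univ.erase i, v i j * (δ i + δ j) := by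
          refine Finset.sum_le_sum fun i _ => Finset.sum_le_sum fun j hj => ?_
          have hij : i ≠ j := (Finset.ne_of_mem_erase hj).symm
          rcases le_total 0 (δ i + δ j) with h | h
          · exact mul_le_mul_of_nonneg_right (hpos i j hij h) h
          · exact mul_le_mul_of_nonpos_right (hneg i j hij h) h
      _ = 2 * ∑ i, δ i * ∑ j ∈ Finset.univ.erase i, v i j := sum_erase_symm_mul_add hv δ
      _ ≤ 2 * ∑ i, |δ i| * ρ := 
          mul_le_mul_of_nonneg_left (Finset.sum_le_sum fun i _ => hrow i) zero_le_two
      _ = 2 * (ρ * L) := by rw [← Finset.sum_mul]; ring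
  rw [sum_erase_symm_mul_add (g := fun i j => a * (δ i + δ j))
    (fun i j => by rw [add_comm])] at hquad
  simp_rw [← Finset.mul_sum, hsumerase] at hquad
  have hexp : ∑ i, δ i * (a * ((p - 2) * δ i + ∑ j, δ j))
      = a * ((p - 2) * ∑ i, |δ i| ^ 2 + (∑ j, δ j) ^ 2) := by
    rw [pow_two (∑ j, δ j), Finset.sum_mul, Finset.mul_sum, ← Finset.sum_add_distrib,
      Finset.mul_sum]
    exact Finset.sum_congr rfl fun i _ => by rw [sq_abs]; ring
  rw [hexp] at hquad
  have hcs : L ^ 2 ≤ p * ∑ i, |δ i| ^ 2 := by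
    simpa using sq_sum_le_card_mul_sum_sq (s := Finset.univ) (f := fun i => |δ i|)
  have h1 : a * ((p - 2) * L ^ 2) ≤ p * (ρ * L) := by
    have : a * ((p - 2) * ∑ i, |δ i| ^ 2) ≤ ρ * L := by
      nlinarith [mul_nonneg ha.le (sq_nonneg (∑ j, δ j))]
    calc a * ((p - 2) * L ^ 2) ≤ a * ((p - 2) * (p * ∑ i, |δ i| ^ 2)) := by
          have : (0 : ℝ) ≤ p - 2 := by linarith
          gcongr
      _ = p * (a * ((p - 2) * ∑ i, |δ i| ^ 2)) := by ring
      _ ≤ p * (ρ * L) := by gcongr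
  obtain ⟨k, -, hk⟩ := Finset.exists_max_image Finset.univ (fun i => |δ i|) ⟨i, Finset.mem_univ i⟩
  refine (hk i (Finset.mem_univ i)).trans ?_
  rcases eq_or_ne (δ k) 0 with h0 | h0
  · rw [h0, abs_zero]; positivity
  have hD : 0 < |δ k| := abs_pos.2 h0
  have hLpos : 0 < L :=
    hD.trans_le (Finset.single_le_sum (f := fun i => |δ i|) (fun i _ => abs_nonneg _)
      (Finset.mem_univ k))
  -- The factor 3 bounds `p / (p - 2)` for `p ≥ 3`.
  have h2 : a * L ≤ 3 * ρ := by
    have h3 : a * (p - 2) * L ≤ p * ρ := by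
      refine le_of_mul_le_mul_right ?_ hLpos
      linarith [h1, pow_two L]
    have h4 : 0 < (p : ℝ) - 2 := by linarith
    have h5 : 0 ≤ p * ρ := le_trans (by positivity) h3
    have h6 : 0 ≤ ρ := nonneg_of_mul_nonneg_right h5 (by linarith)
    refine le_of_mul_le_mul_left (a := (p : ℝ) - 2) ?_ h4
    nlinarith
  -- From ℓ¹ to the maximum norm: as `|δ k|` is maximal, every `δ k + δ j` has the sign `σ` of `δ
  -- k`, so row `k` alone controls `(p - 1) |δ k|` up to the ℓ¹ norm.
  have hbound : ∀ σ : ℝ, σ = 1 ∨ σ = -1 → |δ k| = σ * δ k → a * ((p - 1) * |δ k|) ≤ ρ + a * L := by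
    intro σ hσ hσk
    have hσσ : σ * σ = 1 := by rcases hσ with rfl | rfl <;> norm_num
    have hrowk : σ * ∑ j ∈ Finset.univ.erase k, v k j ≤ ρ := by
      refine le_of_mul_le_mul_left (a := |δ k|) ?_ hD
      calc |δ k| * (σ * ∑ j ∈ Finset.univ.erase k, v k j)
          = (σ * σ) * (δ k * ∑ j ∈ Finset.univ.erase k, v k j) := by rw [hσk]; ring
        _ ≤ |δ k| * ρ := by rw [hσσ, one_mul]; exact hrow k
    have hterm : ∀ j ∈ Finset.univ.erase k, a * (|δ k| - |δ j|) ≤ σ * v k j := by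
      intro j hj
      have hkj : k ≠ j := (Finset.ne_of_mem_erase hj).symm
      have hj' := hk j (Finset.mem_univ j)
      have habs := abs_le.1 (le_refl |δ j|)
      rcases hσ with rfl | rfl
      · rw [one_mul] at hσk ⊢
        refine le_trans ?_ (hpos k j hkj (by linarith))
        exact mul_le_mul_of_nonneg_left (by linarith) ha.le
      · have h := hneg k j hkj (by linarith)
        have : a * (|δ k| - |δ j|) ≤ a * (-(δ k + δ j)) :=
          mul_le_mul_of_nonneg_left (by linarith) ha.le
        linarith
    have hsum := Finset.sum_le_sum hterm
    rw [← Finset.mul_sum, ← Finset.mul_sum, Finset.sum_sub_distrib, Finset.sum_const,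
      nsmul_eq_mul, hcard] at hsum
    have hle : ∑ j ∈ Finset.univ.erase k, |δ j| ≤ L :=
      Finset.sum_le_sum_of_subset_of_nonneg (Finset.erase_subset _ _) fun i _ _ => abs_nonneg _
    nlinarith
  have hfin : a * ((p - 1) * |δ k|) ≤ 4 * ρ := by
    rcases le_total 0 (δ k) with h | h
    · linarith [hbound 1 (Or.inl rfl) (by rw [abs_of_nonneg h, one_mul])]
    · linarith [hbound (-1) (Or.inr rfl) (by rw [abs_of_nonpos h]; ring)]
  rw [le_div_iff₀ ha]
  refine le_of_mul_le_mul_left (a := (p : ℝ) - 1) ?_ (by linarith)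
  rw [hρ] at hfin
  linarith

/-- A symmetric system of strictly monotone pairwise equations has at most one solution. -/
lemma eq_of_rowSum_eq {p : ℕ} (hp : 3 ≤ p) {f : Fin p → Fin p → ℝ → ℝ}
    (hf : ∀ i j, f i j = f j i) (hmono : ∀ i j, i ≠ j → StrictMono (f i j)) {b b' : Fin p → ℝ}
    (h : ∀ i, ∑ j ∈ Finset.univ.erase i, f i j (b i + b j)
      = ∑ j ∈ Finset.univ.erase i, f i j (b' i + b' j)) : b = b' := by
  have hsum : ∑ i, ∑ j ∈ Finset.univ.erase i,
      (f i j (b i + b j) - f i j (b' i + b' j)) * ((b i - b' i) + (b j - b' j)) = 0 := by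
    rw [sum_erase_symm_mul_add (g := fun i j => f i j (b i + b j) - f i j (b' i + b' j))
      (fun i j => by rw [hf i j, add_comm (b i), add_comm (b' i)]) (fun i => b i - b' i)]
    simp [Finset.sum_sub_distrib, h]
  have hnn : ∀ i, ∀ j ∈ Finset.univ.erase i,
      0 ≤ (f i j (b i + b j) - f i j (b' i + b' j)) * ((b i - b' i) + (b j - b' j)) := by
    intro i j hj
    have hm := (hmono i j (Finset.ne_of_mem_erase hj).symm).monotone
    rcases le_total (b i + b j) (b' i + b' j) with hle | hle
    · exact mul_nonneg_of_nonpos_of_nonpos (sub_nonpos.2 (hm hle)) (by linarith)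
    · exact mul_nonneg (sub_nonneg.2 (hm hle)) (by linarith)
  have hpair : ∀ i j, i ≠ j → (b i - b' i) + (b j - b' j) = 0 := by
    intro i j hij
    have h1 := (Finset.sum_eq_zero_iff_of_nonneg
      fun i _ => Finset.sum_nonneg (hnn i)).1 hsum i (Finset.mem_univ i)
    have h2 := (Finset.sum_eq_zero_iff_of_nonneg (hnn i)).1 h1 j
      (Finset.mem_erase.2 ⟨hij.symm, Finset.mem_univ j⟩)
    rcases mul_eq_zero.1 h2 with h3 | h3
    · have := (hmono i j hij).injective (sub_eq_zero.1 h3)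
      linarith
    · exact h3
  -- The differences cancel on every edge of a triangle; an odd cycle forces each of them to vanish.
  funext i
  obtain ⟨j, hj⟩ : ∃ j : Fin p, j ∉ ({i} : Finset (Fin p)) :=
    Finset.exists_mem_notMem_of_card_lt_card (s := {i}) (t := Finset.univ) (by simp; omega)
      |>.imp fun _ h => h.2
  obtain ⟨l, hl⟩ : ∃ l : Fin p, l ∉ ({i, j} : Finset (Fin p)) :=
    Finset.exists_mem_notMem_of_card_lt_card (s := {i, j}) (t := Finset.univ)
      (lt_of_le_of_lt Finset.card_le_two (by simp; omega)) |>.imp fun _ h => h.2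
  simp only [Finset.mem_insert, Finset.mem_singleton, not_or] at hj hl
  linarith [hpair i j (Ne.symm hj), hpair i l (Ne.symm hl.1), hpair j l (Ne.symm hl.2)]

/-- A continuous symmetric system of pairwise equations that is nearly solved at `b₀`, with slopes
bounded below near `b₀`, has a solution near `b₀`. -/
lemma exists_rowSum_eq {p : ℕ} (hp : 3 ≤ p) {f : Fin p → Fin p → ℝ → ℝ}
    (hf : ∀ i j, f i j = f j i) (hcont : ∀ i j, Continuous (f i j)) {b₀ d : Fin p → ℝ}
    {a s R : ℝ} (ha : 0 < a) (hs : 0 ≤ s) (hR : 4 * s / a < R)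
    (hslope : ∀ i j, i ≠ j → ∀ x y, |x - (b₀ i + b₀ j)| ≤ 2 * R → |y - (b₀ i + b₀ j)| ≤ 2 * R →
      y ≤ x → a * (x - y) ≤ f i j x - f i j y)
    (hd : ∀ i, |∑ j ∈ Finset.univ.erase i, f i j (b₀ i + b₀ j) - d i| ≤ (p - 1) * s) :
    ∃ b : Fin p → ℝ, (∀ i, |b i - b₀ i| ≤ 4 * s / a) ∧
      ∀ i, ∑ j ∈ Finset.univ.erase i, f i j (b i + b j) = d i := by
  have hR0 : 0 < R := lt_of_le_of_lt (by positivity) hR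
  -- By symmetry the system is a gradient: each unordered pair occurs twice in the double sum,
  -- whence the factor 2 on the linear part.
  let Φ : (Fin p → ℝ) → ℝ := fun b =>
    (∑ i, ∑ j ∈ Finset.univ.erase i, ∫ x in (0 : ℝ)..(b i + b j), f i j x) - 2 * ∑ i, d i * b i
  let Φ' : (Fin p → ℝ) → ((Fin p → ℝ) →L[ℝ] ℝ) := fun b =>
    (∑ i, ∑ j ∈ Finset.univ.erase i, f i j (b i + b j) •
      (ContinuousLinearMap.proj (R := ℝ) (φ := fun _ : Fin p => ℝ) i +
        ContinuousLinearMap.proj (R := ℝ) (φ := fun _ : Fin p => ℝ) j))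
    - (2 : ℝ) • ∑ i, d i • ContinuousLinearMap.proj (R := ℝ) (φ := fun _ : Fin p => ℝ) i
  have hΦ : ∀ b, HasFDerivAt Φ (Φ' b) b := by
    intro b
    refine HasFDerivAt.sub (HasFDerivAt.fun_sum fun i _ => HasFDerivAt.fun_sum fun j _ => ?_)
      (HasFDerivAt.const_mul (HasFDerivAt.fun_sum fun i _ => ?_) 2)
    · exact (intervalIntegral.integral_hasDerivAt_right ((hcont i j).intervalIntegrable _ _)
        ((hcont i j).stronglyMeasurableAtFilter _ _) (hcont i j).continuousAt).comp_hasFDerivAt b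
        ((ContinuousLinearMap.proj (R := ℝ) (φ := fun _ : Fin p => ℝ) i).hasFDerivAt.add
          (ContinuousLinearMap.proj (R := ℝ) (φ := fun _ : Fin p => ℝ) j).hasFDerivAt)
    · exact (ContinuousLinearMap.proj (R := ℝ) (φ := fun _ : Fin p => ℝ) i).hasFDerivAt.const_mul _
  let G : (Fin p → ℝ) → Fin p → ℝ := fun b i =>
    ∑ j ∈ Finset.univ.erase i, f i j (b i + b j) - d i
  have hΦ' : ∀ b y, Φ' b y = 2 * ∑ i, y i * G b i := by
    intro b y
    have := sum_erase_symm_mul_add (g := fun i j => f i j (b i + b j))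
      (fun i j => by rw [hf i j, add_comm (b i)]) y
    simp only [Φ', G, sub_apply, sum_apply,
      smul_apply, add_apply, ContinuousLinearMap.proj_apply,
      smul_eq_mul, this, mul_sub, Finset.sum_sub_distrib]
    congr 2
    exact Finset.sum_congr rfl fun i _ => mul_comm _ _
  have hcontΦ : Continuous Φ := continuous_iff_continuousAt.2 fun b => (hΦ b).continuousAt
  obtain ⟨b, hb, hmin⟩ := (isCompact_closedBall b₀ R).exists_isMinOn
    (Metric.nonempty_closedBall.2 hR0.le) hcontΦ.continuousOn
  have hbi : ∀ i, |b i - b₀ i| ≤ R := by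
    intro i
    have := dist_le_pi_dist b b₀ i
    rw [Real.dist_eq] at this
    exact this.trans hb
  -- The box allows coordinate `i` to move back to `b₀ i` alone, so the first-order condition at a
  -- minimizer, possibly on the boundary, fixes this sign. A one-sided bound is all that
  -- `abs_le_of_rowSum_le` asks of the rows.
  have hG : ∀ i, (b i - b₀ i) * G b i ≤ 0 := by
    intro i
    have hmem : b + Pi.single i (-(b i - b₀ i)) ∈ Metric.closedBall b₀ R := by
      rw [Metric.mem_closedBall, dist_pi_le_iff hR0.le]
      intro k
      rw [Real.dist_eq]
      by_cases hk : k = i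
      · subst hk; simp [hR0.le]
      · simpa [Pi.single_eq_of_ne hk] using hbi k
    have h0 := hmin.localize.hasFDerivWithinAt_nonneg (hΦ b).hasFDerivWithinAt
      (mem_posTangentConeAt_of_segment_subset
        ((convex_closedBall b₀ R).segment_subset hb hmem))
    rw [hΦ', Finset.sum_eq_single i (fun k _ hk => by rw [Pi.single_eq_of_ne hk, zero_mul])
      (by simp), Pi.single_eq_same] at h0
    linarith
  have habs := abs_le_of_rowSum_le hp
    (v := fun i j => f i j (b i + b j) - f i j (b₀ i + b₀ j)) (δ := fun i => b i - b₀ i)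
    (fun i j => by rw [hf i j, add_comm (b i), add_comm (b₀ i)]) ha hs
    (fun i j hij h => by
      have := hslope i j hij (b i + b j) (b₀ i + b₀ j)
        (by
          rw [add_sub_add_comm, two_mul]
          exact (abs_add_le _ _).trans (add_le_add (hbi i) (hbi j)))
        (by simpa using hR0.le) (by linarith)
      convert this using 2
      ring)
    (fun i j hij h => by
      have := hslope i j hij (b₀ i + b₀ j) (b i + b j) (by simpa using hR0.le)
        (by
          rw [add_sub_add_comm, two_mul]
          exact (abs_add_le _ _).trans (add_le_add (hbi i) (hbi j)))
        (by linarith)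
      nlinarith)
    (fun i => by
      have h1 := hG i
      have h2 : -((b i - b₀ i) * (∑ j ∈ Finset.univ.erase i, f i j (b₀ i + b₀ j) - d i))
          ≤ |b i - b₀ i| * ((p - 1) * s) := by
        refine (neg_le_abs _).trans ?_
        rw [abs_mul]
        exact mul_le_mul_of_nonneg_left (hd i) (abs_nonneg _)
      rw [Finset.sum_sub_distrib]
      simp only [G] at h1
      nlinarith)
  refine ⟨b, habs, fun i => ?_⟩
  -- Since `4 * s / a < R`, the minimizer is interior, so the gradient vanishes there.
  have hint : Metric.closedBall b₀ R ∈ 𝓝 b := by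
    refine mem_of_superset (Metric.isOpen_ball.mem_nhds ?_) Metric.ball_subset_closedBall
    rw [Metric.mem_ball, dist_pi_lt_iff hR0]
    intro k
    rw [Real.dist_eq]
    exact (habs k).trans_lt hR
  have hzero := (hmin.isLocalMin hint).hasFDerivAt_eq_zero (hΦ b)
  have h1 := hΦ' b (Pi.single i 1)
  rw [hzero, Finset.sum_eq_single i (fun k _ hk => by rw [Pi.single_eq_of_ne hk, zero_mul])
      (by simp), Pi.single_eq_same] at h1
  simp only [zero_apply, G] at h1
  linarith

/-! ### The moment equations -/

lemma exp_div_one_add_exp (x : ℝ) : Real.exp x / (1 + Real.exp x) = 1 - 1 / (1 + Real.exp x) := by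
  have := Real.exp_pos x
  field_simp
  ring

lemma one_sub_inv_sub (B x y : ℝ) (hB : 1 ≤ B) :
    (1 - 1 / (B + Real.exp x)) - (1 - 1 / (B + Real.exp y))
      = (Real.exp x - Real.exp y) / ((B + Real.exp x) * (B + Real.exp y)) := by
  have := Real.exp_pos x
  have := Real.exp_pos y
  have : B + Real.exp x ≠ 0 := by positivity
  have : B + Real.exp y ≠ 0 := by positivity
  field_simp
  ring

lemma strictMono_one_sub_inv {B : ℝ} (hB : 1 ≤ B) :
    StrictMono fun x => 1 - 1 / (B + Real.exp x) := by
  intro y x hyx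
  have := Real.exp_pos x
  have := Real.exp_pos y
  have h := one_sub_inv_sub B x y hB
  have : 0 < (Real.exp x - Real.exp y) / ((B + Real.exp x) * (B + Real.exp y)) :=
    div_pos (sub_pos.2 (Real.exp_lt_exp.2 hyx)) (by positivity)
  simp only
  linarith

lemma continuous_one_sub_inv {B : ℝ} (hB : 1 ≤ B) :
    Continuous fun x => 1 - 1 / (B + Real.exp x) := by
  refine continuous_const.sub (continuous_const.div (by fun_prop) fun x => ?_)
  have := Real.exp_pos x
  positivity

lemma exp_sub_exp_bounds {x y : ℝ} :
    Real.exp y * (x - y) ≤ Real.exp x - Real.exp y ∧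
      Real.exp x - Real.exp y ≤ Real.exp x * (x - y) := by
  have key : ∀ a b : ℝ, Real.exp a * (b - a) ≤ Real.exp b - Real.exp a := by
    intro a b
    have h := Real.add_one_le_exp (b - a)
    have h2 : Real.exp b = Real.exp a * Real.exp (b - a) := by rw [← Real.exp_add]; congr 1; ring
    rw [h2]
    nlinarith [Real.exp_pos a]
  exact ⟨key y x, by linarith [key x y]⟩

/-- The factor `exp y` from the numerator cancels against `B + exp y ≤ 2 * B * exp M * exp y`, which
holds because `y ≥ -M`. -/
lemma slope_one_sub_inv {B M x y : ℝ} (hB : 1 ≤ B) (hx : |x| ≤ M) (hy : |y| ≤ M) (hyx : y ≤ x) :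
    1 / (4 * B ^ 2 * Real.exp (2 * M)) * (x - y)
      ≤ (1 - 1 / (B + Real.exp x)) - (1 - 1 / (B + Real.exp y)) := by
  have hex := Real.exp_pos x
  have hey := Real.exp_pos y
  have hM : 1 ≤ Real.exp M := Real.one_le_exp ((abs_nonneg x).trans hx)
  have h1 : B + Real.exp x ≤ 2 * B * Real.exp M := by
    have : Real.exp x ≤ Real.exp M := Real.exp_le_exp.2 ((le_abs_self x).trans hx)
    nlinarith
  have h2 : B + Real.exp y ≤ 2 * B * Real.exp M * Real.exp y := by
    have h3 : 1 ≤ Real.exp M * Real.exp y := by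
      rw [← Real.exp_add]
      exact Real.one_le_exp (by linarith [neg_abs_le y])
    nlinarith
  rw [one_sub_inv_sub B x y hB]
  calc 1 / (4 * B ^ 2 * Real.exp (2 * M)) * (x - y)
      = (Real.exp y * (x - y)) / ((2 * B * Real.exp M) * (2 * B * Real.exp M * Real.exp y)) := by
        rw [two_mul M, Real.exp_add]
        field_simp
        ring
    _ ≤ (Real.exp x - Real.exp y) / ((B + Real.exp x) * (B + Real.exp y)) := by
        have h0 : 0 ≤ Real.exp y * (x - y) := mul_nonneg hey.le (sub_nonneg.2 hyx)
        have := exp_sub_exp_bounds (x := x) (y := y)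
        gcongr
        · linarith
        · exact this.1

lemma abs_one_sub_inv_sub_le {B x y : ℝ} (hB : 1 ≤ B) :
    |(1 - 1 / (B + Real.exp x)) - (1 - 1 / (B + Real.exp y))| ≤ |x - y| := by
  wlog hyx : y ≤ x generalizing x y
  · rw [abs_sub_comm, abs_sub_comm x]
    exact this (le_of_not_ge hyx)
  have hex := Real.exp_pos x
  have hey := Real.exp_pos y
  rw [one_sub_inv_sub B x y hB, abs_of_nonneg (sub_nonneg.2 hyx),
    abs_of_nonneg (div_nonneg (sub_nonneg.2 (Real.exp_le_exp.2 hyx)) (by positivity)),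
    div_le_iff₀ (by positivity)]
  have h := (exp_sub_exp_bounds (x := x) (y := y)).2
  have h2 : Real.exp x ≤ (B + Real.exp x) * (B + Real.exp y) := by nlinarith
  nlinarith [sub_nonneg.2 hyx]

lemma one_sub_inv_mem {B : ℝ} (hB : 1 ≤ B) (x : ℝ) :
    0 ≤ 1 - 1 / (B + Real.exp x) ∧ 1 - 1 / (B + Real.exp x) ≤ 1 := by
  have hex := Real.exp_pos x
  constructor
  · rw [sub_nonneg, div_le_one (by positivity)]
    linarith
  · have : 0 < 1 / (B + Real.exp x) := by positivity
    linarith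

lemma isMME_iff {p n : ℕ} (hn : n ≠ 0) (x : ℕ → Fin p → Fin p → ℤ) (θ : TWHMParam p) :
    IsMME n x θ ↔
      (∀ i, ∑ j ∈ Finset.univ.erase i, (1 - 1 / (1 + Real.exp (θ 0 i + θ 0 j)))
        = (∑ t ∈ Finset.Icc 1 n, ∑ j ∈ Finset.univ.erase i, (x t i j : ℝ)) / n) ∧
      ∀ i, ∑ j ∈ Finset.univ.erase i, (1 - 1 / (1 + Real.exp (θ 0 i + θ 0 j))) *
          (1 - 1 / (1 + Real.exp (θ 0 i + θ 0 j) + Real.exp (θ 1 i + θ 1 j)))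
        = (∑ t ∈ Finset.Icc 1 n, ∑ j ∈ Finset.univ.erase i,
          (x t i j : ℝ) * (x (t - 1) i j : ℝ)) / n := by
  have hn' : (n : ℝ) ≠ 0 := Nat.cast_ne_zero.2 hn
  have hdyn : ∀ i, ∑ t ∈ Finset.Icc 1 n, ∑ j ∈ Finset.univ.erase i,
      ((x t i j : ℝ) * (x (t - 1) i j : ℝ)
        - odds θ 0 i j / (1 + odds θ 0 i j) * (1 - 1 / (1 + odds θ 0 i j + odds θ 1 i j)))
      = ∑ t ∈ Finset.Icc 1 n, ∑ j ∈ Finset.univ.erase i, (x t i j : ℝ) * (x (t - 1) i j : ℝ)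
        - n * ∑ j ∈ Finset.univ.erase i,
        odds θ 0 i j / (1 + odds θ 0 i j) * (1 - 1 / (1 + odds θ 0 i j + odds θ 1 i j)) := by
    intro i
    simp_rw [Finset.sum_sub_distrib]
    rw [Finset.sum_const, Nat.card_Icc, nsmul_eq_mul, Nat.add_sub_cancel]
  simp only [← exp_div_one_add_exp]
  constructor
  · rintro ⟨h0, h1⟩
    refine ⟨fun i => (sub_eq_zero.1 (h0 i)).symm, fun i => ?_⟩
    have h := h1 i
    rw [hdyn, sub_eq_zero] at h
    rw [h, mul_div_cancel_left₀ _ hn']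
    rfl
  · rintro ⟨h0, h1⟩
    refine ⟨fun i => sub_eq_zero.2 (h0 i).symm, fun i => ?_⟩
    rw [hdyn, sub_eq_zero, eq_comm, mul_comm, ← eq_div_iff hn']
    exact h1 i

/-- The static system determines the first component; once it is fixed, the dynamic system is
strictly monotone in the pair sums of the second. -/
lemma IsMME.unique {p n : ℕ} (hp : 3 ≤ p) (hn : n ≠ 0) {x : ℕ → Fin p → Fin p → ℤ}
    {η η' : TWHMParam p} (h : IsMME n x η) (h' : IsMME n x η') : η = η' := by
  rw [isMME_iff hn] at h h'
  have h0 : η 0 = η' 0 := eq_of_rowSum_eq hp (f := fun _ _ x => 1 - 1 / (1 + Real.exp x))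
    (fun _ _ => rfl) (fun _ _ _ => strictMono_one_sub_inv le_rfl)
    fun i => (h.1 i).trans (h'.1 i).symm
  have h1 : η 1 = η' 1 := by
    refine eq_of_rowSum_eq hp
      (f := fun i j x => (1 - 1 / (1 + Real.exp (η 0 i + η 0 j))) *
        (1 - 1 / (1 + Real.exp (η 0 i + η 0 j) + Real.exp x)))
      (fun i j => by simp only [add_comm (η 0 i)]) (fun i j _ => ?_)
      fun i => (h.2 i).trans ?_
    · refine (strictMono_one_sub_inv ?_).const_mul ?_
      · linarith [Real.exp_pos (η 0 i + η 0 j)]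
      · rw [← exp_div_one_add_exp]
        positivity
    · rw [← h'.2 i, h0]
  funext r
  fin_cases r
  · exact h0
  · exact h1

/-- If the moments of the data are close to those of the parameter `θ`, the moment equations have a
solution close to `θ`. -/
lemma exists_isMME {p n : ℕ} (hp : 3 ≤ p) (hn : n ≠ 0) {x : ℕ → Fin p → Fin p → ℤ}
    {θ : TWHMParam p} {s : ℝ} (hs : 0 ≤ s)
    (hstat : ∀ i, |∑ j ∈ Finset.univ.erase i, (1 - 1 / (1 + Real.exp (θ 0 i + θ 0 j)))
        - (∑ t ∈ Finset.Icc 1 n, ∑ j ∈ Finset.univ.erase i, (x t i j : ℝ)) / n| ≤ (p - 1) * s)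
    (hdyn : ∀ i, |∑ j ∈ Finset.univ.erase i, (1 - 1 / (1 + Real.exp (θ 0 i + θ 0 j))) *
          (1 - 1 / (1 + Real.exp (θ 0 i + θ 0 j) + Real.exp (θ 1 i + θ 1 j)))
        - (∑ t ∈ Finset.Icc 1 n, ∑ j ∈ Finset.univ.erase i,
          (x t i j : ℝ) * (x (t - 1) i j : ℝ)) / n| ≤ (p - 1) * s)
    (hsmall : 8320 * Real.exp (10 * ‖θ 0‖ + 4 * ‖θ 1‖ + 7) * s < 1 / 2) :
    ∃ η, IsMME n x η ∧ ‖η - θ‖ ≤ 8320 * Real.exp (10 * ‖θ 0‖ + 4 * ‖θ 1‖ + 7) * s := by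
  have hp' : (3 : ℝ) ≤ p := by exact_mod_cast hp
  -- `U` and `M` bound the pair sums while each coordinate moves by at most `R = 1 / 2`.
  set U := 2 * ‖θ 0‖ + 1 with hU
  set M := 2 * ‖θ 1‖ + 1 with hM
  have hU0 : 0 ≤ U := by positivity
  have hM0 : 0 ≤ M := by positivity
  set E := Real.exp (10 * ‖θ 0‖ + 4 * ‖θ 1‖ + 7) with hE
  have hEU : E = Real.exp (3 * U + 2 * M) * Real.exp (2 * U) := by
    rw [hE, ← Real.exp_add, hU, hM]; congr 1; ring
  have hE0 : 0 < E := by rw [hE]; positivity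
  clear_value U M E
  have hpair : ∀ r i j, |θ r i + θ r j| ≤ 2 * ‖θ r‖ := fun r i j => by
    have h1 := norm_le_pi_norm (θ r) i
    have h2 := norm_le_pi_norm (θ r) j
    rw [Real.norm_eq_abs] at h1 h2
    linarith [abs_add_le (θ r i) (θ r j)]
  have hwin : ∀ r i j y, |y - (θ r i + θ r j)| ≤ 2 * (1 / 2) → |y| ≤ 2 * ‖θ r‖ + 1 := by
    intro r i j y hy
    have := abs_add_le (y - (θ r i + θ r j)) (θ r i + θ r j)
    rw [sub_add_cancel] at this
    linarith [hpair r i j]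
  set Δ := 16 * Real.exp (2 * U) * s with hΔ
  have hΔ0 : 0 ≤ Δ := by positivity
  have hΔeq : 4 * s / (1 / (4 * 1 ^ 2 * Real.exp (2 * U))) = Δ := by
    rw [hΔ]; field_simp; ring
  have hexp1 : 1 ≤ Real.exp (3 * U + 2 * M) := Real.one_le_exp (by positivity)
  have hexp2 : 1 ≤ Real.exp (2 * U) := Real.one_le_exp (by positivity)
  have hΔle : Δ ≤ 8320 * E * s := by
    rw [hΔ, hEU]
    gcongr
    · norm_num
    · exact le_mul_of_one_le_left (by positivity) hexp1
  have hΔhalf : Δ < 1 / 2 := hΔle.trans_lt hsmall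
  obtain ⟨b, hb, hbeq⟩ := exists_rowSum_eq hp (f := fun _ _ x => 1 - 1 / (1 + Real.exp x))
    (fun _ _ => rfl) (fun _ _ => continuous_one_sub_inv le_rfl) (b₀ := θ 0)
    (a := 1 / (4 * 1 ^ 2 * Real.exp (2 * U))) (R := 1 / 2) (by positivity) hs
    (by rw [hΔeq]; exact hΔhalf)
    (fun i j _ y z hy hz hzy => slope_one_sub_inv le_rfl (hU ▸ hwin 0 i j y hy)
      (hU ▸ hwin 0 i j z hz) hzy)
    hstat
  rw [hΔeq] at hb
  have hbpair : ∀ i j, |(b i + b j) - (θ 0 i + θ 0 j)| ≤ 2 * Δ := by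
    intro i j
    rw [add_sub_add_comm, two_mul]
    exact (abs_add_le _ _).trans (add_le_add (hb i) (hb j))
  have hbU : ∀ i j, |b i + b j| ≤ U := fun i j =>
    hU ▸ hwin 0 i j _ ((hbpair i j).trans (by linarith))
  -- The dynamic system is perturbed by the sampling error `s` and by at most `4 * Δ` from plugging
  -- in the static solution; `8320 = 128 * 65`.
  have hs1 : 4 * (4 * Δ + s) / (1 / (32 * Real.exp (3 * U + 2 * M))) ≤ 8320 * E * s := by
    have h : 4 * (4 * Δ + s) / (1 / (32 * Real.exp (3 * U + 2 * M)))
        = 128 * Real.exp (3 * U + 2 * M) * ((64 * Real.exp (2 * U) + 1) * s) := by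
      rw [hΔ]; field_simp; ring
    rw [h, hEU]
    have : (64 * Real.exp (2 * U) + 1) * s ≤ 65 * Real.exp (2 * U) * s := by
      gcongr; linarith
    calc _ ≤ 128 * Real.exp (3 * U + 2 * M) * (65 * Real.exp (2 * U) * s) := by gcongr
      _ = _ := by ring
  have hB1 : ∀ i j, 1 ≤ 1 + Real.exp (b i + b j) := fun i j => by
    linarith [Real.exp_pos (b i + b j)]
  obtain ⟨b', hb', hbeq'⟩ := exists_rowSum_eq hp
    (f := fun i j x => (1 - 1 / (1 + Real.exp (b i + b j))) *
        (1 - 1 / (1 + Real.exp (b i + b j) + Real.exp x)))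
    (d := fun i => (∑ t ∈ Finset.Icc 1 n, ∑ j ∈ Finset.univ.erase i,
          (x t i j : ℝ) * (x (t - 1) i j : ℝ)) / n)
    (fun i j => by simp only [add_comm (b i)])
    (fun i j => continuous_const.mul (continuous_one_sub_inv (hB1 i j))) (b₀ := θ 1)
    (a := 1 / (32 * Real.exp (3 * U + 2 * M))) (s := 4 * Δ + s) (R := 1 / 2) (by positivity)
    (by positivity) (hs1.trans_lt hsmall)
    (fun i j _ y z hy hz hzy => by
      have hslope := slope_one_sub_inv (hB1 i j) (hwin 1 i j y hy) (hwin 1 i j z hz) hzy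
      rw [← hM] at hslope
      have hu := Real.exp_pos (b i + b j)
      have hEb : Real.exp (b i + b j) ≤ Real.exp U :=
        Real.exp_le_exp.2 ((le_abs_self _).trans (hbU i j))
      have hone : 1 ≤ Real.exp U := Real.one_le_exp hU0
      -- The slope constant is the product of this bound and `1 / (16 * exp (2U) * exp (2M))`, the
      -- latter from `slope_one_sub_inv` with `B ≤ 2 * exp U`.
      have hm : 1 / (2 * Real.exp U) ≤ 1 - 1 / (1 + Real.exp (b i + b j)) := by
        rw [← exp_div_one_add_exp, div_le_div_iff₀ (by positivity) (by positivity)]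
        have : 1 ≤ Real.exp U * Real.exp (b i + b j) := by
          rw [← Real.exp_add]
          exact Real.one_le_exp (by linarith [neg_abs_le (b i + b j), hbU i j])
        nlinarith
      rw [← mul_sub]
      refine le_trans ?_ (mul_le_mul hm hslope
        (mul_nonneg (by positivity) (sub_nonneg.2 hzy)) ((by positivity : (0 : ℝ) ≤ _).trans hm))
      rw [← mul_assoc]
      refine mul_le_mul_of_nonneg_right ?_ (sub_nonneg.2 hzy)
      rw [div_mul_div_comm, one_mul]
      refine one_div_le_one_div_of_le (by positivity) ?_
      have hBU : 1 + Real.exp (b i + b j) ≤ 2 * Real.exp U := by linarith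
      calc 2 * Real.exp U * (4 * (1 + Real.exp (b i + b j)) ^ 2 * Real.exp (2 * M))
          ≤ 2 * Real.exp U * (4 * (2 * Real.exp U) ^ 2 * Real.exp (2 * M)) := by gcongr
        _ = 32 * Real.exp (3 * U + 2 * M) := by
          rw [Real.exp_add, show 3 * U = U + U + U by ring, Real.exp_add, Real.exp_add]; ring)
    (fun i => by
      have hterm : ∀ j ∈ Finset.univ.erase i,
          |(1 - 1 / (1 + Real.exp (b i + b j))) *
            (1 - 1 / (1 + Real.exp (b i + b j) + Real.exp (θ 1 i + θ 1 j)))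
            - (1 - 1 / (1 + Real.exp (θ 0 i + θ 0 j))) *
            (1 - 1 / (1 + Real.exp (θ 0 i + θ 0 j) + Real.exp (θ 1 i + θ 1 j)))| ≤ 4 * Δ := by
        intro j _
        have hA : 1 ≤ 1 + Real.exp (θ 1 i + θ 1 j) := by linarith [Real.exp_pos (θ 1 i + θ 1 j)]
        -- The dynamic exponential is moved into the constant `B`, so both factors are 1-Lipschitz
        -- in the static pair sum, which moved by at most `2 * Δ`.
        rw [add_right_comm 1 (Real.exp (b i + b j)), add_right_comm 1 (Real.exp (θ 0 i + θ 0 j))]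
        have e1 := (abs_one_sub_inv_sub_le (B := 1) le_rfl).trans (hbpair i j)
        have e2 := (abs_one_sub_inv_sub_le hA).trans (hbpair i j)
        have m1 := one_sub_inv_mem hA (b i + b j)
        have m2 := one_sub_inv_mem (le_refl (1 : ℝ)) (θ 0 i + θ 0 j)
        generalize 1 - 1 / (1 + Real.exp (b i + b j)) = q at *
        generalize 1 - 1 / (1 + Real.exp (θ 0 i + θ 0 j)) = q' at *
        generalize 1 - 1 / (1 + Real.exp (θ 1 i + θ 1 j) + Real.exp (b i + b j)) = g at *
        generalize 1 - 1 / (1 + Real.exp (θ 1 i + θ 1 j) + Real.exp (θ 0 i + θ 0 j)) = g' at *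
        have : q * g - q' * g' = (q - q') * g + q' * (g - g') := by ring
        rw [this]
        refine (abs_add_le _ _).trans ?_
        rw [abs_mul, abs_mul, abs_of_nonneg m1.1, abs_of_nonneg m2.1]
        have k1 : |q - q'| * g ≤ 2 * Δ * 1 := mul_le_mul e1 m1.2 m1.1 (by positivity)
        have k2 : q' * |g - g'| ≤ 1 * (2 * Δ) := mul_le_mul m2.2 e2 (abs_nonneg _) zero_le_one
        linarith
      have hsum := (Finset.abs_sum_le_sum_abs _ _).trans (Finset.sum_le_sum hterm)
      rw [Finset.sum_const, nsmul_eq_mul, Finset.card_erase_of_mem (Finset.mem_univ i),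
        Finset.card_univ, Fintype.card_fin, Nat.cast_sub (by omega), Nat.cast_one,
        Finset.sum_sub_distrib] at hsum
      have := (abs_sub_le _ _ _).trans (add_le_add hsum (hdyn i))
      linarith)
  refine ⟨![b, b'], (isMME_iff hn _ _).2 ⟨?_, ?_⟩, ?_⟩
  · simpa using hbeq
  · simpa using hbeq'
  · have hnn : 0 ≤ 8320 * E * s := by positivity
    rw [pi_norm_le_iff_of_nonneg hnn]
    intro r
    rw [pi_norm_le_iff_of_nonneg hnn]
    intro i
    rw [Real.norm_eq_abs]
    fin_cases r
    · exact (hb i).trans hΔle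
    · exact (hb' i).trans hs1

/-! ### Independence and sub-Gaussian tools -/

/-- The σ-algebras generated by disjoint groups of independent σ-algebras are independent. -/
lemma iIndep_iSup_of_pairwise_disjoint {Ω ι κ : Type*} {m : ι → MeasurableSpace Ω}
    {m0 : MeasurableSpace Ω} {μ : Measure Ω} (h_le : ∀ i, m i ≤ m0) (h : iIndep m μ)
    {S : κ → Set ι} (hS : Pairwise (Function.onFun Disjoint S)) :
    iIndep (fun k => ⨆ i ∈ S k, m i) μ := by
  classical
  have := h.isProbabilityMeasure
  rw [iIndep_iff]
  intro s
  induction s using Finset.induction_on with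
  | empty => intro A _; simp
  | insert a s ha ih =>
    intro A hA
    rw [Finset.set_biInter_insert, Finset.prod_insert ha,
      ← ih fun i hi => hA i (Finset.mem_insert_of_mem hi)]
    have hdisj : Disjoint (S a) (⋃ k ∈ s, S k) := by
      rw [Set.disjoint_iUnion₂_right]
      intro k hk
      exact hS fun hak => ha (hak ▸ hk)
    refine (Indep_iff _ _ _).1 (indep_iSup_of_disjoint h_le h hdisj) _ _
      (hA a (Finset.mem_insert_self _ _)) ?_
    refine Finset.measurableSet_biInter s fun k hk => ?_
    have hle : (⨆ i ∈ S k, m i) ≤ ⨆ i ∈ ⋃ k ∈ s, S k, m i :=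
      biSup_mono fun i hi => Set.mem_biUnion (by exact hk) hi
    exact hle _ (hA k (Finset.mem_insert_of_mem hk))

lemma iIndepFun_of_measurable {Ω κ β : Type*} {m : κ → MeasurableSpace Ω}
    {m0 : MeasurableSpace Ω} {mβ : MeasurableSpace β} {μ : Measure Ω} (h : iIndep m μ)
    {T : κ → Ω → β} (hT : ∀ k, Measurable[m k] (T k)) : iIndepFun T μ := by
  rw [iIndepFun_iff]
  intro s A hA
  refine (iIndep_iff _ _).1 h s fun i hi => ?_
  exact (hT i).comap_le _ (hA i hi)

lemma ProbabilityTheory.HasSubgaussianMGF.mono {Ω : Type*} {m0 : MeasurableSpace Ω}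
    {μ : Measure Ω} {X : Ω → ℝ} {c c' : NNReal} (h : HasSubgaussianMGF X c μ) (hc : c ≤ c') :
    HasSubgaussianMGF X c' μ where
  integrable_exp_mul := h.integrable_exp_mul
  mgf_le t := (h.mgf_le t).trans (Real.exp_le_exp.2 (by gcongr))

/-! ### Two-state chains driven by independent innovations -/

/-- A stationary chain `X` with values in `{0, 1}`, started at `Y 0`, that moves to `1` when the
innovation is `0`, stays when it is `1`, and moves to `0` otherwise. -/
structure IsTwoStateChain {Ω : Type*} [MeasurableSpace Ω] (μ : Measure Ω) (Y X : ℕ → Ω → ℤ)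
    (q ρ m : ℝ) : Prop where
  indep : iIndepFun Y μ
  measurable : ∀ t, Measurable (Y t)
  binary : ∀ t ω, X t ω = 0 ∨ X t ω = 1
  init : ∀ ω, X 0 ω = Y 0 ω
  step : ∀ t ω, X (t + 1) ω
    = (if Y (t + 1) ω = 0 then 1 else 0) + X t ω * (if Y (t + 1) ω = 1 then 1 else 0)
  prob_zero : ∀ t, μ.real {ω | Y (t + 1) ω = 0} = q
  prob_one : ∀ t, μ.real {ω | Y (t + 1) ω = 1} = ρ
  prob_init : μ.real {ω | X 0 ω = 1} = m
  stationary : q + m * ρ = m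

/-- The σ-algebra generated by the first innovations. -/
abbrev innovPast {Ω : Type*} (Y : ℕ → Ω → ℤ) (t : ℕ) : MeasurableSpace Ω :=
  ⨆ i ∈ Set.Iic t, MeasurableSpace.comap (Y i) ⊤

lemma measurable_innovPast {Ω : Type*} (Y : ℕ → Ω → ℤ) {s t : ℕ} (h : s ≤ t) :
    Measurable[innovPast Y t] (Y s) := by
  have hle : MeasurableSpace.comap (Y s) ⊤ ≤ innovPast Y t :=
    le_biSup (fun i => MeasurableSpace.comap (Y i) ⊤) (Set.mem_Iic.2 h)
  exact (comap_measurable (Y s)).mono hle le_rfl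

lemma innovPast_mono {Ω : Type*} (Y : ℕ → Ω → ℤ) : Monotone (innovPast Y) := fun _ _ h =>
  biSup_mono fun _ hi => le_trans (Set.mem_Iic.1 hi) h

namespace IsTwoStateChain

variable {Ω : Type*} [m0 : MeasurableSpace Ω] {μ : Measure Ω} {Y X : ℕ → Ω → ℤ} {q ρ m : ℝ}

lemma innovPast_le (h : IsTwoStateChain μ Y X q ρ m) (t : ℕ) : innovPast Y t ≤ m0 :=
  iSup₂_le fun i _ => (h.measurable i).comap_le

lemma measurable_state (h : IsTwoStateChain μ Y X q ρ m) (t : ℕ) :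
    Measurable[innovPast Y t] (X t) := by
  induction t with
  | zero =>
    rw [show X 0 = Y 0 from funext h.init]
    exact measurable_innovPast Y le_rfl
  | succ t ih =>
    rw [show X (t + 1) = fun ω => (fun z : ℤ => if z = 0 then (1 : ℤ) else 0) (Y (t + 1) ω)
      + X t ω * (fun z : ℤ => if z = 1 then (1 : ℤ) else 0) (Y (t + 1) ω) from
      funext (h.step t)]
    have hY : Measurable[innovPast Y (t + 1)] (Y (t + 1)) := measurable_innovPast Y le_rfl
    have hX : Measurable[innovPast Y (t + 1)] (X t) :=
      ih.mono (innovPast_mono Y t.le_succ) le_rfl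
    exact ((measurable_from_top (f := fun z : ℤ => if z = 0 then (1 : ℤ) else 0)).comp hY).add
      (hX.mul ((measurable_from_top (f := fun z : ℤ => if z = 1 then (1 : ℤ) else 0)).comp hY))

lemma measurable_state_real (h : IsTwoStateChain μ Y X q ρ m) {s t : ℕ} (hst : s ≤ t) :
    Measurable[innovPast Y t] (fun ω => (X s ω : ℝ)) :=
  measurable_from_top.comp ((h.measurable_state s).mono (innovPast_mono Y hst) le_rfl)

/-- This replaces conditional expectations: adapted quantities involve only `Y 0, …, Y t`. -/
lemma indepFun_innov (h : IsTwoStateChain μ Y X q ρ m) {t : ℕ} {Z : Ω → ℝ}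
    (hZ : Measurable[innovPast Y t] Z) (ψ : ℤ → ℝ) :
    IndepFun Z (fun ω => ψ (Y (t + 1) ω)) μ := by
  have hdisj : Disjoint (Set.Iic t) {t + 1} := by simp
  have hind := indep_iSup_of_disjoint (fun i => (h.measurable i).comap_le) h.indep hdisj
  rw [IndepFun_iff_Indep]
  refine indep_of_indep_of_le_left (indep_of_indep_of_le_right hind ?_) hZ.comap_le
  rw [iSup_singleton]
  exact (measurable_from_top.comp (comap_measurable (Y (t + 1)))).comap_le

lemma integral_indicator [IsProbabilityMeasure μ] (h : IsTwoStateChain μ Y X q ρ m) (t : ℕ) :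
    ∫ ω, (if Y (t + 1) ω = 0 then (1 : ℝ) else 0) ∂μ = q ∧
      ∫ ω, (if Y (t + 1) ω = 1 then (1 : ℝ) else 0) ∂μ = ρ := by
  constructor
  · rw [← h.prob_zero t, ← integral_indicator_one (s := {ω | Y (t + 1) ω = 0})
      (h.measurable (t + 1) (measurableSet_singleton 0))]
    exact integral_congr_ae (ae_of_all _ fun ω => by simp [Set.indicator_apply])
  · rw [← h.prob_one t, ← integral_indicator_one (s := {ω | Y (t + 1) ω = 1})
      (h.measurable (t + 1) (measurableSet_singleton 1))]
    exact integral_congr_ae (ae_of_all _ fun ω => by simp [Set.indicator_apply])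

lemma integrable_state [IsProbabilityMeasure μ] (h : IsTwoStateChain μ Y X q ρ m) (t : ℕ) :
    Integrable (fun ω => (X t ω : ℝ)) μ := by
  refine Integrable.of_mem_Icc 0 1
    (((h.measurable_state_real le_rfl).mono (h.innovPast_le t) le_rfl).aemeasurable)
    (ae_of_all _ fun ω => ?_)
  rcases h.binary t ω with h0 | h0 <;> simp [h0]

lemma integral_state [IsProbabilityMeasure μ] (h : IsTwoStateChain μ Y X q ρ m) (t : ℕ) :
    ∫ ω, (X t ω : ℝ) ∂μ = m := by
  induction t with
  | zero =>
    rw [← h.prob_init, ← integral_indicator_one (s := {ω | X 0 ω = 1})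
      (((h.measurable_state 0).mono (h.innovPast_le 0) le_rfl) (measurableSet_singleton 1))]
    refine integral_congr_ae (ae_of_all _ fun ω => ?_)
    rcases h.binary 0 ω with h0 | h0 <;> simp [h0]
  | succ t ih =>
    have hind := h.indepFun_innov (h.measurable_state_real (le_refl t))
      (fun z => if z = 1 then (1 : ℝ) else 0)
    have hmeas : ∀ ψ : ℤ → ℝ, Measurable (fun ω => ψ (Y (t + 1) ω)) := fun ψ =>
      measurable_from_top.comp (h.measurable (t + 1))
    have hint : ∀ a : ℤ, Integrable (fun ω => if Y (t + 1) ω = a then (1 : ℝ) else 0) μ := by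
      intro a
      refine Integrable.of_mem_Icc 0 1 (hmeas (fun z => if z = a then 1 else 0)).aemeasurable
        (ae_of_all _ fun ω => ?_)
      split_ifs <;> simp
    have hX : ∀ ω, (X (t + 1) ω : ℝ) = (if Y (t + 1) ω = 0 then (1 : ℝ) else 0)
        + (X t ω : ℝ) * (if Y (t + 1) ω = 1 then (1 : ℝ) else 0) := by
      intro ω
      rw [h.step t ω]
      push_cast
      rfl
    simp_rw [hX]
    have hprod : Integrable (fun ω => (X t ω : ℝ) * (if Y (t + 1) ω = 1 then (1 : ℝ) else 0)) μ :=
      hind.integrable_mul (h.integrable_state t) (hint 1)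
    rw [integral_add (hint 0) hprod,
      (h.integral_indicator t).1]
    have hmul := hind.integral_fun_mul_eq_mul_integral (h.integrable_state t).aestronglyMeasurable
      (hint 1).aestronglyMeasurable
    rw [hmul, ih, (h.integral_indicator t).2, h.stationary]

/-- Azuma's inequality: sums of increments that are functions of the innovation, chosen according
to the current state, are sub-Gaussian. -/
lemma hasSubgaussianMGF_sum [IsProbabilityMeasure μ] (h : IsTwoStateChain μ Y X q ρ m)
    {V₀ V₁ : ℤ → ℝ} {c : NNReal} (h₀ : ∀ t, HasSubgaussianMGF (fun ω => V₀ (Y (t + 1) ω)) c μ)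
    (h₁ : ∀ t, HasSubgaussianMGF (fun ω => V₁ (Y (t + 1) ω)) c μ) (n : ℕ) :
    HasSubgaussianMGF (fun ω => ∑ t ∈ Finset.range n,
      ((X t ω : ℝ) * V₁ (Y (t + 1) ω) + (1 - (X t ω : ℝ)) * V₀ (Y (t + 1) ω))) (n * c) μ := by
  induction n with
  | zero => simp
  | succ n ih =>
    set M : Ω → ℝ := fun ω => ∑ t ∈ Finset.range n,
      ((X t ω : ℝ) * V₁ (Y (t + 1) ω) + (1 - (X t ω : ℝ)) * V₀ (Y (t + 1) ω)) with hM
    have hMmeas : Measurable[innovPast Y n] M := by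
      refine Finset.measurable_fun_sum _ fun t ht => ?_
      have htn := Finset.mem_range.1 ht
      have hx := h.measurable_state_real htn.le
      have hV : ∀ V : ℤ → ℝ, Measurable[innovPast Y n] (fun ω => V (Y (t + 1) ω)) := fun V =>
        measurable_from_top.comp (measurable_innovPast Y htn)
      exact (hx.mul (hV V₁)).add ((measurable_const.sub hx).mul (hV V₀))
    have hxm := h.measurable_state_real (le_refl n)
    -- Splitting by the current state makes each summand an adapted factor times a function of the
    -- next innovation, so its expectation factorizes.
    have hexp : ∀ u ω, Real.exp (u * ∑ t ∈ Finset.range (n + 1),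
        ((X t ω : ℝ) * V₁ (Y (t + 1) ω) + (1 - (X t ω : ℝ)) * V₀ (Y (t + 1) ω)))
        = (X n ω : ℝ) * Real.exp (u * M ω) * Real.exp (u * V₁ (Y (n + 1) ω))
          + (1 - (X n ω : ℝ)) * Real.exp (u * M ω) * Real.exp (u * V₀ (Y (n + 1) ω)) := by
      intro u ω
      rw [Finset.sum_range_succ, mul_add, Real.exp_add]
      rcases h.binary n ω with h0 | h0 <;> simp [h0, hM]
    have hint : ∀ u, Integrable (fun ω => (X n ω : ℝ) * Real.exp (u * M ω)) μ ∧
        Integrable (fun ω => (1 - (X n ω : ℝ)) * Real.exp (u * M ω)) μ := by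
      intro u
      have hbd : ∀ g : Ω → ℝ, Measurable[innovPast Y n] g → (∀ ω, |g ω| ≤ 1) →
          Integrable (fun ω => g ω * Real.exp (u * M ω)) μ := fun g hg hb =>
        (ih.integrable_exp_mul u).bdd_mul
          ((hg.mono (h.innovPast_le n) le_rfl).aestronglyMeasurable) (ae_of_all _ hb)
      refine ⟨hbd _ hxm fun ω => ?_, hbd _ (measurable_const.sub hxm) fun ω => ?_⟩ <;>
      · rcases h.binary n ω with h0 | h0 <;> simp [h0]
    have hind₁ : ∀ u, IndepFun (fun ω => (X n ω : ℝ) * Real.exp (u * M ω))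
        (fun ω => Real.exp (u * V₁ (Y (n + 1) ω))) μ := fun u =>
      h.indepFun_innov (hxm.mul (Real.measurable_exp.comp (hMmeas.const_mul u)))
        (fun z => Real.exp (u * V₁ z))
    have hind₀ : ∀ u, IndepFun (fun ω => (1 - (X n ω : ℝ)) * Real.exp (u * M ω))
        (fun ω => Real.exp (u * V₀ (Y (n + 1) ω))) μ := fun u =>
      h.indepFun_innov ((measurable_const.sub hxm).mul
        (Real.measurable_exp.comp (hMmeas.const_mul u))) (fun z => Real.exp (u * V₀ z))
    have hint₁ : ∀ u, Integrable (fun ω =>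
        (X n ω : ℝ) * Real.exp (u * M ω) * Real.exp (u * V₁ (Y (n + 1) ω))) μ := fun u =>
      (hind₁ u).integrable_mul (hint u).1 ((h₁ n).integrable_exp_mul u)
    have hint₀ : ∀ u, Integrable (fun ω =>
        (1 - (X n ω : ℝ)) * Real.exp (u * M ω) * Real.exp (u * V₀ (Y (n + 1) ω))) μ := fun u =>
      (hind₀ u).integrable_mul (hint u).2 ((h₀ n).integrable_exp_mul u)
    refine ⟨fun u => ?_, fun u => ?_⟩
    · simp_rw [hexp]
      exact (hint₁ u).add (hint₀ u)
    · rw [mgf]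
      simp_rw [hexp]
      rw [integral_add (hint₁ u) (hint₀ u),
        (hind₁ u).integral_fun_mul_eq_mul_integral (hint u).1.aestronglyMeasurable
          ((h₁ n).integrable_exp_mul u).aestronglyMeasurable,
        (hind₀ u).integral_fun_mul_eq_mul_integral (hint u).2.aestronglyMeasurable
          ((h₀ n).integrable_exp_mul u).aestronglyMeasurable]
      have hnn : 0 ≤ ∫ ω, (X n ω : ℝ) * Real.exp (u * M ω) ∂μ ∧
          0 ≤ ∫ ω, (1 - (X n ω : ℝ)) * Real.exp (u * M ω) ∂μ := by
        refine ⟨integral_nonneg fun ω => ?_, integral_nonneg fun ω => ?_⟩ <;>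
        · rcases h.binary n ω with h0 | h0 <;> simp [h0, Real.exp_nonneg]
      have hsplit : ∫ ω, (X n ω : ℝ) * Real.exp (u * M ω) ∂μ
          + ∫ ω, (1 - (X n ω : ℝ)) * Real.exp (u * M ω) ∂μ = mgf M μ u := by
        rw [← integral_add (hint u).1 (hint u).2, mgf]
        exact integral_congr_ae (ae_of_all _ fun ω => by ring)
      have e₁ := mul_le_mul_of_nonneg_left ((h₁ n).mgf_le u) hnn.1
      have e₀ := mul_le_mul_of_nonneg_left ((h₀ n).mgf_le u) hnn.2
      refine (add_le_add e₁ e₀).trans ?_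
      rw [← add_mul, hsplit]
      refine (mul_le_mul_of_nonneg_right (ih.mgf_le u) (Real.exp_nonneg _)).trans (le_of_eq ?_)
      rw [← Real.exp_add]
      congr 1
      push_cast
      ring

/-- Hoeffding's lemma for a variable with values in `[0, B]`. -/
lemma hasSubgaussianMGF_innov [IsProbabilityMeasure μ] (h : IsTwoStateChain μ Y X q ρ m)
    {k : ℝ} {B : NNReal} (hk0 : 0 ≤ k) (hkB : k ≤ B) (t : ℕ) (A : Set ℤ) {r : ℝ}
    (hr : ∫ ω, A.indicator (fun _ => (1 : ℝ)) (Y (t + 1) ω) ∂μ = r) :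
    HasSubgaussianMGF (fun ω => k * (A.indicator (fun _ => (1 : ℝ)) (Y (t + 1) ω) - r))
      ((B / 2) ^ 2) μ := by
  have hb := hasSubgaussianMGF_of_mem_Icc (μ := μ) (a := 0) (b := B)
    (X := fun ω => k * A.indicator (fun _ => (1 : ℝ)) (Y (t + 1) ω))
    ((measurable_from_top (f := fun z : ℤ => k * A.indicator (fun _ => (1 : ℝ)) z)).comp
      (h.measurable (t + 1))).aemeasurable
    (ae_of_all _ fun ω => by
      by_cases hA : Y (t + 1) ω ∈ A <;> simp [hA, hk0, hkB])
  rw [integral_const_mul, hr] at hb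
  simp_rw [← mul_sub] at hb
  simpa using hb

/-- Additive functionals of the chain, written through a solution of the Poisson equation, are
sub-Gaussian. -/
lemma hasSubgaussianMGF_poisson [IsProbabilityMeasure μ] (h : IsTwoStateChain μ Y X q ρ m)
    {k₀ k₁ γ : ℝ} {B : NNReal} (hk₀ : 0 ≤ k₀) (hk₀B : k₀ ≤ B) (hk₁ : 0 ≤ k₁) (hk₁B : k₁ ≤ B)
    (hγ : 0 ≤ γ) (hγB : γ ≤ B) {n : ℕ} (hn : 1 ≤ n) :
    HasSubgaussianMGF (fun ω => ∑ t ∈ Finset.range n,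
      ((X t ω : ℝ) * (k₁ * (X (t + 1) ω - (q + ρ))) + (1 - (X t ω : ℝ)) * (k₀ * (X (t + 1) ω - q))
        - γ * (X (t + 1) ω - X t ω))) (9 / 4 * n * B ^ 2) μ := by
  have hmeas : ∀ (A : Set ℤ) t,
      Integrable (fun ω => A.indicator (fun _ => (1 : ℝ)) (Y (t + 1) ω)) μ := by
    intro A t
    refine Integrable.of_mem_Icc 0 1 ((measurable_from_top
      (f := fun z : ℤ => A.indicator (fun _ => (1 : ℝ)) z)).comp
      (h.measurable (t + 1))).aemeasurable (ae_of_all _ fun ω => ?_)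
    by_cases hA : Y (t + 1) ω ∈ A <;> simp [hA]
  have hr0 : ∀ t, ∫ ω, ({0} : Set ℤ).indicator (fun _ => (1 : ℝ)) (Y (t + 1) ω) ∂μ = q := by
    intro t
    rw [← (h.integral_indicator t).1]
    exact integral_congr_ae (ae_of_all _ fun ω => by simp [Set.indicator_apply])
  have hr1 : ∀ t, ∫ ω, ({0, 1} : Set ℤ).indicator (fun _ => (1 : ℝ)) (Y (t + 1) ω) ∂μ
      = q + ρ := by
    intro t
    have h1 : ∫ ω, ({1} : Set ℤ).indicator (fun _ => (1 : ℝ)) (Y (t + 1) ω) ∂μ = ρ := by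
      rw [← (h.integral_indicator t).2]
      exact integral_congr_ae (ae_of_all _ fun ω => by simp [Set.indicator_apply])
    rw [← hr0 t, ← h1, ← integral_add (hmeas _ t) (hmeas _ t)]
    refine integral_congr_ae (ae_of_all _ fun ω => ?_)
    by_cases h0 : Y (t + 1) ω = 0
    · simp [h0]
    · simp [Set.indicator_apply, h0]
  -- From state 1 the chain is next at 1 exactly when the innovation lies in `{0, 1}`; from state 0,
  -- exactly when it is `0`.
  have hmart := h.hasSubgaussianMGF_sum
    (fun t => h.hasSubgaussianMGF_innov hk₀ hk₀B t {0} (hr0 t))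
    (V₁ := fun z => k₁ * (({0, 1} : Set ℤ).indicator (fun _ => (1 : ℝ)) z - (q + ρ)))
    (V₀ := fun z => k₀ * (({0} : Set ℤ).indicator (fun _ => (1 : ℝ)) z - q))
    (fun t => h.hasSubgaussianMGF_innov hk₁ hk₁B t {0, 1} (hr1 t)) n
  -- The telescoped boundary term is bounded, and centred by stationarity. It depends on the
  -- martingale, so the square roots of the proxies are added below: `√n * B / 2 + B ≤ 3 / 2 * √n *
  -- B`.
  have hrem : HasSubgaussianMGF (fun ω => γ * ((X 0 ω : ℝ) - X n ω)) (B ^ 2) μ := by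
    have hb := hasSubgaussianMGF_of_mem_Icc_of_integral_eq_zero (μ := μ) (a := -B) (b := B)
      (X := fun ω => γ * ((X 0 ω : ℝ) - X n ω))
      (((h.integrable_state 0).sub (h.integrable_state n)).const_mul γ).aemeasurable
      (ae_of_all _ fun ω => by
        rcases h.binary 0 ω with h0 | h0 <;> rcases h.binary n ω with h1 | h1 <;>
          simp [h0, h1] <;> constructor <;> linarith)
      (by rw [integral_const_mul, integral_sub (h.integrable_state 0) (h.integrable_state n),
        h.integral_state, h.integral_state, sub_self, mul_zero])
    refine hb.mono (le_of_eq ?_)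
    congr 1
    rw [sub_neg_eq_add, ← two_mul]
    ext
    simp
  refine ((hmart.add hrem).mono ?_).congr (ae_of_all _ fun ω => ?_)
  · have hs : NNReal.sqrt (n * (B / 2) ^ 2) + NNReal.sqrt (B ^ 2)
        ≤ 3 / 2 * NNReal.sqrt n * B := by
      rw [NNReal.sqrt_mul, NNReal.sqrt_sq, NNReal.sqrt_sq]
      have h1 : 1 ≤ NNReal.sqrt n := by
        rw [NNReal.one_le_sqrt]
        exact_mod_cast hn
      have h2 : B ≤ NNReal.sqrt n * B := le_mul_of_one_le_left zero_le h1
      calc NNReal.sqrt n * (B / 2) + B ≤ NNReal.sqrt n * (B / 2) + NNReal.sqrt n * B := by gcongr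
        _ = 3 / 2 * NNReal.sqrt n * B := by
          ext
          push_cast
          ring
    calc (NNReal.sqrt (n * (B / 2) ^ 2) + NNReal.sqrt (B ^ 2)) ^ 2
        ≤ (3 / 2 * NNReal.sqrt n * B) ^ 2 := by gcongr
      _ = 9 / 4 * n * B ^ 2 := by
        rw [mul_pow, mul_pow, NNReal.sq_sqrt]
        norm_num
  · simp only
    rw [Finset.sum_sub_distrib, ← Finset.mul_sum,
      Finset.sum_range_sub (fun t => (X t ω : ℝ)), ← neg_sub (X n ω : ℝ), mul_neg, ← sub_eq_add_neg]
    congr 1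
    refine Finset.sum_congr rfl fun t _ => ?_
    have hst := h.step t ω
    rcases h.binary t ω with h0 | h0
    · rw [hst]
      simp [h0, Set.indicator_apply]
    · rw [hst]
      by_cases hz : Y (t + 1) ω = 0
      · simp [h0, hz]
      · simp [h0, hz, Set.indicator_apply]

end IsTwoStateChain

/-! ### Sub-Gaussian bounds for the two moments of a single pair -/

lemma sum_Icc_one_eq_sum_range {M : Type*} [AddCommMonoid M] (f : ℕ → M) (n : ℕ) :
    ∑ t ∈ Finset.Icc 1 n, f t = ∑ t ∈ Finset.range n, f (t + 1) := by
  induction n with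
  | zero => simp
  | succ n ih => rw [Finset.sum_Icc_succ_top (by omega), ih, Finset.sum_range_succ]

namespace IsTwoStateChain

variable {Ω : Type*} [m0 : MeasurableSpace Ω] {μ : Measure Ω} {Y X : ℕ → Ω → ℤ} {α β : ℝ}

/-- The Poisson equation is solved by `k₀ = k₁ = 1 / (1 - ρ)` with `ρ = β / (1 + α + β)`, and `γ =
k₀ - 1`. These are at most `1 + β` whatever `α` is, so the proxy does not involve the static
parameter. -/
lemma hasSubgaussianMGF_static [IsProbabilityMeasure μ] (hα : 0 < α) (hβ : 0 < β)
    (h : IsTwoStateChain μ Y X (α / (1 + α + β)) (β / (1 + α + β)) (α / (1 + α)))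
    {B : NNReal} (hB : 2 + β ≤ B) {n : ℕ} (hn : 1 ≤ n) :
    HasSubgaussianMGF (fun ω => ∑ t ∈ Finset.Icc 1 n, ((X t ω : ℝ) - (1 - 1 / (1 + α))))
      (9 / 4 * n * B ^ 2) μ := by
  have hγ : β / (1 + α) ≤ β := div_le_self hβ.le (by linarith)
  have hγ0 : 0 < β / (1 + α) := by positivity
  refine (h.hasSubgaussianMGF_poisson (k₀ := 1 + β / (1 + α)) (k₁ := 1 + β / (1 + α))
    (γ := β / (1 + α)) (by linarith) (by linarith) (by linarith) (by linarith) hγ0.le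
    (by linarith) hn).congr (ae_of_all _ fun ω => ?_)
  simp only
  rw [sum_Icc_one_eq_sum_range]
  refine Finset.sum_congr rfl fun t _ => ?_
  rcases h.binary t ω with h0 | h0 <;> rw [h0] <;> push_cast <;> field_simp <;> ring

/-- Here `k₀ = γ` cancels the next state when the current one is 0, and `k₁ = 1 + γ` leaves it with
coefficient 1 when the current one is 1. This `k₁` is what requires `2 + β ≤ B`. -/
lemma hasSubgaussianMGF_dynamic [IsProbabilityMeasure μ] (hα : 0 < α) (hβ : 0 < β)
    (h : IsTwoStateChain μ Y X (α / (1 + α + β)) (β / (1 + α + β)) (α / (1 + α)))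
    {B : NNReal} (hB : 2 + β ≤ B) {n : ℕ} (hn : 1 ≤ n) :
    HasSubgaussianMGF (fun ω => ∑ t ∈ Finset.Icc 1 n, ((X t ω : ℝ) * (X (t - 1) ω : ℝ)
      - (1 - 1 / (1 + α)) * (1 - 1 / (1 + α + β)))) (9 / 4 * n * B ^ 2) μ := by
  have hγ : (α + β) / (1 + α) ≤ 1 + β := by
    rw [div_le_iff₀ (by linarith)]
    nlinarith
  have hγ0 : 0 < (α + β) / (1 + α) := by positivity
  refine (h.hasSubgaussianMGF_poisson (k₀ := (α + β) / (1 + α)) (k₁ := 1 + (α + β) / (1 + α))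
    (γ := (α + β) / (1 + α)) (by linarith) (by linarith) (by linarith) (by linarith) hγ0.le
    (by linarith) hn).congr (ae_of_all _ fun ω => ?_)
  simp only
  rw [sum_Icc_one_eq_sum_range]
  refine Finset.sum_congr rfl fun t _ => ?_
  rw [Nat.add_sub_cancel]
  rcases h.binary t ω with h0 | h0 <;> rw [h0] <;> push_cast <;> field_simp <;> ring

end IsTwoStateChain

/-! ### Concentration of the moments of the network -/

lemma odds_pos {p : ℕ} (θ : TWHMParam p) (r : Fin 2) (i j : Fin p) : 0 < odds θ r i j :=
  Real.exp_pos _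

/-- The pair of two distinct nodes. -/
def edgeOf {p : ℕ} (i j : Fin p) (h : i ≠ j) : EdgeIdx p := ⟨(min i j, max i j), min_lt_max.2 h⟩

lemma edgeOf_right_injective {p : ℕ} {i j k : Fin p} (hj : i ≠ j) (hk : i ≠ k)
    (h : edgeOf i j hj = edgeOf i k hk) : j = k := by
  simp only [edgeOf, Subtype.mk.injEq, Prod.mk.injEq] at h
  rcases le_total i j with h1 | h1 <;> rcases le_total i k with h2 | h2 <;>
    simp only [h1, h2, min_eq_left, min_eq_right, max_eq_left, max_eq_right] at h <;> grind

/-- The initial state and the innovations of a pair of nodes. -/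
def edgeInnov {p : ℕ} {Ω : Type*} (X ε : ℕ → Fin p → Fin p → Ω → ℤ) (e : EdgeIdx p) (t : ℕ) :
    Ω → ℤ :=
  if t = 0 then X 0 e.1.1 e.1.2 else ε t e.1.1 e.1.2

namespace IsStationaryTWHM

variable {p : ℕ} {Ω : Type*} [m0 : MeasurableSpace Ω] {μ : Measure Ω} {θ : TWHMParam p}
  {X ε : ℕ → Fin p → Fin p → Ω → ℤ}

lemma measurable_edgeInnov (h : IsStationaryTWHM μ θ X ε) (e : EdgeIdx p) (t : ℕ) :
    Measurable (edgeInnov X ε e t) := by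
  rcases Nat.eq_zero_or_pos t with rfl | ht
  · simpa [edgeInnov] using h.measurable_init _ _ e.2
  · simpa [edgeInnov, ht.ne'] using h.measurable_innov t _ _ ht e.2

lemma iIndepFun_edgeInnov (h : IsStationaryTWHM μ θ X ε) :
    iIndepFun (fun k : EdgeIdx p × ℕ => edgeInnov X ε k.1 k.2) μ := by
  let g : EdgeIdx p × ℕ → EdgeIdx p ⊕ (EdgeIdx p × ℕ) := fun k =>
    if k.2 = 0 then Sum.inl k.1 else Sum.inr (k.1, k.2 - 1)
  have hg : Function.Injective g := by
    rintro ⟨e, s⟩ ⟨e', t⟩ hst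
    rcases Nat.eq_zero_or_pos s with rfl | hs <;> rcases Nat.eq_zero_or_pos t with rfl | ht
    · simpa [g] using hst
    · simp [g, ht.ne'] at hst
    · simp [g, hs.ne'] at hst
    · simp only [g, hs.ne', ht.ne', if_false, Sum.inr.injEq, Prod.mk.injEq] at hst
      exact Prod.ext hst.1 (by have := hst.2; omega)
  convert h.indep.precomp hg using 1
  funext k
  rcases k with ⟨e, t⟩
  rcases Nat.eq_zero_or_pos t with rfl | ht
  · simp [edgeInnov, g]
  · simp [edgeInnov, g, ht.ne', Nat.sub_add_cancel ht]

lemma isTwoStateChain (h : IsStationaryTWHM μ θ X ε) (e : EdgeIdx p) :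
    IsTwoStateChain μ (edgeInnov X ε e) (fun t => X t e.1.1 e.1.2)
      (odds θ 0 e.1.1 e.1.2 / (1 + odds θ 0 e.1.1 e.1.2 + odds θ 1 e.1.1 e.1.2))
      (odds θ 1 e.1.1 e.1.2 / (1 + odds θ 0 e.1.1 e.1.2 + odds θ 1 e.1.1 e.1.2))
      (odds θ 0 e.1.1 e.1.2 / (1 + odds θ 0 e.1.1 e.1.2)) where
  indep := h.iIndepFun_edgeInnov.precomp (g := fun t => (e, t)) (Prod.mk_right_injective e)
  measurable := h.measurable_edgeInnov e
  binary t ω := h.binary t _ _ ω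
  init ω := by simp [edgeInnov]
  step t ω := by simpa [edgeInnov] using h.step (t + 1) _ _ ω (by omega) e.2
  prob_zero t := by simpa [edgeInnov] using h.innov_zero (t + 1) _ _ (by omega) e.2
  prob_one t := by simpa [edgeInnov] using h.innov_one (t + 1) _ _ (by omega) e.2
  prob_init := h.init _ _ e.2
  stationary := by
    have h0 := odds_pos θ 0 e.1.1 e.1.2
    have h1 := odds_pos θ 1 e.1.1 e.1.2
    field_simp

/-- Functionals of the histories of different pairs of nodes are independent. -/
lemma iIndepFun_sum (h : IsStationaryTWHM μ θ X ε) (g : EdgeIdx p → ℤ → ℤ → ℝ) (n : ℕ) :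
    iIndepFun (fun (e : EdgeIdx p) ω => ∑ t ∈ Finset.Icc 1 n,
      g e (X t e.1.1 e.1.2 ω) (X (t - 1) e.1.1 e.1.2 ω)) μ := by
  have hdisj : Pairwise (Function.onFun Disjoint
      fun e : EdgeIdx p => {k : EdgeIdx p × ℕ | k.1 = e}) := by
    intro e e' hne
    exact Set.disjoint_left.2 fun k hk hk' => hne (hk.symm.trans hk')
  refine iIndepFun_of_measurable (iIndep_iSup_of_pairwise_disjoint
    (m := fun k : EdgeIdx p × ℕ => MeasurableSpace.comap (edgeInnov X ε k.1 k.2) ⊤)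
    (fun k => (h.measurable_edgeInnov k.1 k.2).comap_le) h.iIndepFun_edgeInnov hdisj) fun e => ?_
  refine Finset.measurable_fun_sum _ fun t _ => ?_
  have hX : ∀ t, Measurable[⨆ k ∈ {k : EdgeIdx p × ℕ | k.1 = e},
      MeasurableSpace.comap (edgeInnov X ε k.1 k.2) ⊤] (X t e.1.1 e.1.2) := by
    intro t
    refine ((h.isTwoStateChain e).measurable_state t).mono ?_ le_rfl
    refine iSup₂_le fun s _ => ?_
    exact le_biSup (fun k : EdgeIdx p × ℕ => MeasurableSpace.comap (edgeInnov X ε k.1 k.2) ⊤)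
      (show ((e, s) : EdgeIdx p × ℕ) ∈ {k : EdgeIdx p × ℕ | k.1 = e} from rfl)
  exact (Measurable.of_discrete (f := fun z : ℤ × ℤ => g e z.1 z.2)).comp
    ((hX t).prodMk (hX (t - 1)))

/-- For fixed `i` the pairs `{i, j}` are distinct, hence their histories are independent and the
proxies add. Symmetry of `g` and `X` passes from ordered pairs to `(i, j)`. -/
lemma hasSubgaussianMGF_rowSum (h : IsStationaryTWHM μ θ X ε)
    {g : Fin p → Fin p → ℤ → ℤ → ℝ} (hg : ∀ i j, g i j = g j i) {n : ℕ} {c : NNReal}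
    (hc : ∀ e : EdgeIdx p, HasSubgaussianMGF (fun ω => ∑ t ∈ Finset.Icc 1 n,
      g e.1.1 e.1.2 (X t e.1.1 e.1.2 ω) (X (t - 1) e.1.1 e.1.2 ω)) c μ) (i : Fin p) :
    HasSubgaussianMGF (fun ω => ∑ j ∈ Finset.univ.erase i, ∑ t ∈ Finset.Icc 1 n,
      g i j (X t i j ω) (X (t - 1) i j ω)) ((p - 1 : ℕ) * c) μ := by
  have hinj : Function.Injective
      fun j : {j // j ∈ Finset.univ.erase i} => edgeOf i j (Finset.ne_of_mem_erase j.2).symm :=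
    fun j k hjk => Subtype.ext (edgeOf_right_injective _ _ hjk)
  have hind := (h.iIndepFun_sum (fun e => g e.1.1 e.1.2) n).precomp hinj
  have hsum := HasSubgaussianMGF.sum_of_iIndepFun hind (s := Finset.univ) fun j _ => hc _
  rw [Finset.sum_const, nsmul_eq_mul, Finset.card_univ, Fintype.card_coe,
    Finset.card_erase_of_mem (Finset.mem_univ i), Finset.card_univ, Fintype.card_fin] at hsum
  refine hsum.congr (ae_of_all _ fun ω => ?_)
  simp only
  rw [← Finset.sum_coe_sort (Finset.univ.erase i)]
  refine Finset.sum_congr rfl fun j _ => Finset.sum_congr rfl fun t _ => ?_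
  rcases le_total i (j : Fin p) with hij | hij
  · simp [edgeOf, hij]
  · simp [edgeOf, hij, hg i, h.symm _ i]

end IsStationaryTWHM

lemma measure_abs_ge_le {Ω : Type*} [MeasurableSpace Ω] {μ : Measure Ω} [IsFiniteMeasure μ]
    {R : Ω → ℝ} {c : NNReal} (h : HasSubgaussianMGF R c μ) {a : ℝ} (ha : 0 ≤ a) :
    μ {ω | a ≤ |R ω|} ≤ ENNReal.ofReal (2 * Real.exp (-a ^ 2 / (2 * c))) := by
  have hsub : {ω | a ≤ |R ω|} ⊆ {ω | a ≤ R ω} ∪ {ω | a ≤ (-R) ω} := by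
    intro ω hω
    simpa [le_abs] using hω
  have hone : ∀ {R : Ω → ℝ}, HasSubgaussianMGF R c μ →
      μ {ω | a ≤ R ω} ≤ ENNReal.ofReal (Real.exp (-a ^ 2 / (2 * c))) := fun hR => by
    rw [← ENNReal.ofReal_toReal (measure_ne_top μ _)]
    exact ENNReal.ofReal_le_ofReal (hR.measure_ge_le ha)
  refine (measure_mono hsub).trans ((measure_union_le _ _).trans ?_)
  rw [two_mul, ENNReal.ofReal_add (Real.exp_nonneg _) (Real.exp_nonneg _)]
  exact add_le_add (hone h) (hone h.neg)

namespace IsStationaryTWHM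

variable {p : ℕ} {Ω : Type*} [m0 : MeasurableSpace Ω] {μ : Measure Ω} {θ : TWHMParam p}
  {X ε : ℕ → Fin p → Fin p → Ω → ℤ}

/-- With high probability the moment equations have a solution near the true parameter. -/
lemma measure_not_exists_isMME_le [IsProbabilityMeasure μ] (h : IsStationaryTWHM μ θ X ε)
    (hp : 3 ≤ p) {n : ℕ} (hn : 1 ≤ n) {s : ℝ} (hs : 0 ≤ s)
    (hsmall : 8320 * Real.exp (10 * ‖θ 0‖ + 4 * ‖θ 1‖ + 7) * s < 1 / 2) :
    μ {ω | ¬ ∃ η, IsMME n (fun t i j => X t i j ω) η ∧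
        ‖η - θ‖ ≤ 8320 * Real.exp (10 * ‖θ 0‖ + 4 * ‖θ 1‖ + 7) * s}
      ≤ ENNReal.ofReal
        (4 * p * Real.exp (-(2 * (n * (p - 1) * s ^ 2)) / (81 * Real.exp (4 * ‖θ 1‖)))) := by
  have hp' : (3 : ℝ) ≤ p := by exact_mod_cast hp
  have hn' : (1 : ℝ) ≤ n := by exact_mod_cast hn
  let B : NNReal := ⟨3 * Real.exp (2 * ‖θ 1‖), by positivity⟩
  have hB : ∀ i j, 2 + odds θ 1 i j ≤ B := by
    intro i j
    have h1 := norm_le_pi_norm (θ 1) i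
    have h2 := norm_le_pi_norm (θ 1) j
    rw [Real.norm_eq_abs] at h1 h2
    have h3 : odds θ 1 i j ≤ Real.exp (2 * ‖θ 1‖) :=
      Real.exp_le_exp.2 (by linarith [le_abs_self (θ 1 i), le_abs_self (θ 1 j)])
    have h4 : 1 ≤ Real.exp (2 * ‖θ 1‖) := Real.one_le_exp (by positivity)
    change 2 + odds θ 1 i j ≤ 3 * Real.exp (2 * ‖θ 1‖)
    linarith
  have hodds : ∀ r i j, odds θ r i j = odds θ r j i := fun r i j => by
    rw [odds, odds, add_comm]
  let g₀ : Fin p → Fin p → ℤ → ℤ → ℝ := fun i j x _ => (x : ℝ) - (1 - 1 / (1 + odds θ 0 i j))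
  let g₁ : Fin p → Fin p → ℤ → ℤ → ℝ := fun i j x y => (x : ℝ) * (y : ℝ)
    - (1 - 1 / (1 + odds θ 0 i j)) * (1 - 1 / (1 + odds θ 0 i j + odds θ 1 i j))
  let R : (Fin p → Fin p → ℤ → ℤ → ℝ) → Fin p → Ω → ℝ := fun g i ω =>
    ∑ j ∈ Finset.univ.erase i, ∑ t ∈ Finset.Icc 1 n, g i j (X t i j ω) (X (t - 1) i j ω)
  have hsub₀ : ∀ i, HasSubgaussianMGF (R g₀ i) ((p - 1 : ℕ) * (9 / 4 * n * B ^ 2)) μ :=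
    h.hasSubgaussianMGF_rowSum (fun i j => by funext x y; simp only [g₀, hodds 0 i j])
      fun e => (h.isTwoStateChain e).hasSubgaussianMGF_static (odds_pos _ _ _ _)
        (odds_pos _ _ _ _) (hB _ _) hn
  have hsub₁ : ∀ i, HasSubgaussianMGF (R g₁ i) ((p - 1 : ℕ) * (9 / 4 * n * B ^ 2)) μ :=
    h.hasSubgaussianMGF_rowSum
      (fun i j => by funext x y; simp only [g₁, hodds 0 i j, hodds 1 i j])
      fun e => (h.isTwoStateChain e).hasSubgaussianMGF_dynamic (odds_pos _ _ _ _)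
        (odds_pos _ _ _ _) (hB _ _) hn
  -- The tolerance `(p - 1) * s` of `exists_isMME`, undone by the division by `n`.
  set a : ℝ := n * ((p - 1) * s) with ha
  have ha0 : 0 ≤ a := mul_nonneg (by linarith) (mul_nonneg (by linarith) hs)
  set E : ℝ := Real.exp (-(2 * (n * (p - 1) * s ^ 2)) / (81 * Real.exp (4 * ‖θ 1‖))) with hE
  have htail : ∀ {Q : Ω → ℝ}, HasSubgaussianMGF Q ((p - 1 : ℕ) * (9 / 4 * n * B ^ 2)) μ →
      μ {ω | a ≤ |Q ω|} ≤ ENNReal.ofReal (2 * E) := by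
    intro Q hQ
    refine (measure_abs_ge_le hQ ha0).trans (le_of_eq ?_)
    rw [hE]
    congr 3
    have hBc : (B : ℝ) = 3 * Real.exp (2 * ‖θ 1‖) := rfl
    have hexp : Real.exp (4 * ‖θ 1‖) = Real.exp (2 * ‖θ 1‖) ^ 2 := by
      rw [← Real.exp_nat_mul]; congr 1; push_cast; ring
    have hpc : ((p - 1 : ℕ) : ℝ) = p - 1 := by rw [Nat.cast_sub (by omega), Nat.cast_one]
    have hp1 : (p : ℝ) - 1 ≠ 0 := by linarith
    have hn0 : (n : ℝ) ≠ 0 := by linarith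
    rw [NNReal.coe_mul, NNReal.coe_natCast, hpc]
    push_cast
    rw [hBc, hexp, ha]
    field_simp
    ring
  have hcover : {ω | ¬ ∃ η, IsMME n (fun t i j => X t i j ω) η ∧
      ‖η - θ‖ ≤ 8320 * Real.exp (10 * ‖θ 0‖ + 4 * ‖θ 1‖ + 7) * s}
      ⊆ ⋃ i : Fin p, ({ω | a ≤ |R g₀ i ω|} ∪ {ω | a ≤ |R g₁ i ω|}) := by
    intro ω hω
    by_contra hnot
    simp only [Set.mem_iUnion, Set.mem_union, Set.mem_ofPred_eq, not_exists, not_or, not_le]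
      at hnot
    refine hω (exists_isMME hp (by omega) hs (fun i => ?_) (fun i => ?_) hsmall)
    · have hi := (hnot i).1.le
      have hR : ∑ j ∈ Finset.univ.erase i, (1 - 1 / (1 + Real.exp (θ 0 i + θ 0 j)))
          - (∑ t ∈ Finset.Icc 1 n, ∑ j ∈ Finset.univ.erase i, (X t i j ω : ℝ)) / n
          = -(R g₀ i ω) / n := by
        simp only [R, g₀, Finset.sum_sub_distrib, odds, Finset.sum_const, Nat.card_Icc,
          Nat.add_sub_cancel, nsmul_eq_mul, ← Finset.mul_sum]
        rw [Finset.sum_comm]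
        field_simp
        ring
      rw [hR, abs_div, abs_neg, abs_of_nonneg (by linarith : (0 : ℝ) ≤ n),
        div_le_iff₀ (by linarith)]
      linarith
    · have hi := (hnot i).2.le
      have hR : ∑ j ∈ Finset.univ.erase i, (1 - 1 / (1 + Real.exp (θ 0 i + θ 0 j))) *
          (1 - 1 / (1 + Real.exp (θ 0 i + θ 0 j) + Real.exp (θ 1 i + θ 1 j)))
          - (∑ t ∈ Finset.Icc 1 n, ∑ j ∈ Finset.univ.erase i,
            (X t i j ω : ℝ) * (X (t - 1) i j ω : ℝ)) / n = -(R g₁ i ω) / n := by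
        simp only [R, g₁, Finset.sum_sub_distrib, odds, Finset.sum_const, Nat.card_Icc,
          Nat.add_sub_cancel, nsmul_eq_mul, ← Finset.mul_sum]
        rw [Finset.sum_comm]
        field_simp
        ring
      rw [hR, abs_div, abs_neg, abs_of_nonneg (by linarith : (0 : ℝ) ≤ n),
        div_le_iff₀ (by linarith)]
      linarith
  have hE0 : 0 ≤ E := Real.exp_nonneg _
  calc _ ≤ μ (⋃ i : Fin p, ({ω | a ≤ |R g₀ i ω|} ∪ {ω | a ≤ |R g₁ i ω|})) := measure_mono hcover
    _ ≤ ∑ i : Fin p, μ ({ω | a ≤ |R g₀ i ω|} ∪ {ω | a ≤ |R g₁ i ω|}) := measure_iUnion_fintype_le _ _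
    _ ≤ ∑ i : Fin p, ENNReal.ofReal (4 * E) := by
        refine Finset.sum_le_sum fun i _ => (measure_union_le _ _).trans ?_
        refine (add_le_add (htail (hsub₀ i)) (htail (hsub₁ i))).trans (le_of_eq ?_)
        rw [← ENNReal.ofReal_add (by positivity) (by positivity)]
        congr 1
        ring
    _ = ENNReal.ofReal (4 * p * E) := by
        rw [Finset.sum_const, Finset.card_univ, Fintype.card_fin, nsmul_eq_mul,
          ← ENNReal.ofReal_natCast, ← ENNReal.ofReal_mul (by positivity)]
        congr 1
        ring

end IsStationaryTWHM

/-! ### Asymptotics along the sequence of models -/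

lemma tendsto_exp_mul_sqrt_mul_exp_neg :
    Tendsto (fun x : ℝ => Real.exp (x / 4) * Real.sqrt (x * Real.exp (-x))) atTop (𝓝 0) := by
  have h1 : Tendsto (fun x : ℝ => Real.sqrt (2 * ((x / 2) ^ 1 * Real.exp (-(x / 2)))))
      atTop (𝓝 (Real.sqrt (2 * 0))) :=
    (((Real.tendsto_pow_mul_exp_neg_atTop_nhds_zero 1).comp
      (tendsto_id.atTop_div_const two_pos)).const_mul 2).sqrt
  rw [mul_zero, Real.sqrt_zero] at h1
  refine h1.congr fun x => ?_
  have h2 : Real.exp (x / 4) = Real.sqrt (Real.exp (x / 2)) := by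
    rw [← Real.exp_half]; congr 1; ring
  rw [h2, ← Real.sqrt_mul (Real.exp_nonneg _)]
  congr 1
  have h3 : Real.exp (-(x / 2)) = Real.exp (x / 2) * Real.exp (-x) := by
    rw [← Real.exp_add]; congr 1; ring
  rw [h3]
  ring

/-- Along the sequence, the moment equations have with high probability a solution at the distance
of the stated rate from the true parameter. -/
lemma exists_eventually_measure_le {n p : ℕ → ℕ} {Ω : ℕ → Type*} [∀ k, MeasurableSpace (Ω k)]
    {μ : ∀ k, Measure (Ω k)} [∀ k, IsProbabilityMeasure (μ k)] {θ : ∀ k, TWHMParam (p k)}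
    {X ε : ∀ k, ℕ → Fin (p k) → Fin (p k) → Ω k → ℤ} (hn : ∀ k, 2 ≤ n k) (hp : ∀ k, 3 ≤ p k)
    (hnp : Tendsto (fun k => n k * p k) atTop atTop)
    (hX : ∀ k, IsStationaryTWHM (μ k) (θ k) (X k) (ε k))
    (hθ : ∀ k, ‖θ k 0‖ + ‖θ k 1‖ ≤ 1 / 40 * Real.log ((n k : ℝ) * (p k : ℝ)))
    {δ : ℝ} (hδ : 0 < δ) :
    ∃ C : ℝ, 0 < C ∧ ∀ᶠ k in atTop, μ k {ω | ¬ ∃ η,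
      IsMME (n k) (fun t i j => X k t i j ω) η ∧ ‖η - θ k‖ ≤
        C * (Real.exp (14 * ‖θ k 0‖ + 6 * ‖θ k 1‖) *
          Real.sqrt (Real.log (n k) * Real.log (p k) / ((n k : ℝ) * (p k : ℝ))))}
      ≤ ENNReal.ofReal δ := by
  -- Chosen so that the failure bound `4p * p ^ (-(1 + a)) = 4 * p ^ (-a)` is at most `δ`, using
  -- `log p ≥ 1`.
  set a := max 0 (Real.log (4 / δ)) with ha
  have ha0 : 0 ≤ a := le_max_left _ _
  -- `243 / 4 = (81 / 2) * (3 / 2)`: the first factor cancels the constant of the tail bound, the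
  -- second absorbs `(p - 1) / p ≥ 2 / 3`.
  set S := Real.sqrt (243 / 4 * (1 + a)) with hS
  have hS0 : 0 < S := Real.sqrt_pos.2 (by positivity)
  have hS2 : S ^ 2 = 243 / 4 * (1 + a) := Real.sq_sqrt (by positivity)
  set D := 8320 * Real.exp 7 * S with hD
  have hD0 : 0 < D := by positivity
  have hlog2 : 0 < Real.log 2 := Real.log_pos one_lt_two
  refine ⟨D / Real.sqrt (Real.log 2), div_pos hD0 (Real.sqrt_pos.2 hlog2), ?_⟩
  have hNtend : Tendsto (fun k => Real.log ((n k : ℝ) * (p k : ℝ))) atTop atTop := by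
    refine Real.tendsto_log_atTop.comp ?_
    have := (tendsto_natCast_atTop_atTop (R := ℝ)).comp hnp
    exact this.congr fun k => by simp
  have hsmall := (tendsto_exp_mul_sqrt_mul_exp_neg.comp hNtend).const_mul D
  rw [mul_zero] at hsmall
  filter_upwards [hsmall.eventually_lt_const (show (0 : ℝ) < 1 / 2 by norm_num)] with k hk
  have hn' : (2 : ℝ) ≤ n k := by exact_mod_cast hn k
  have hp' : (3 : ℝ) ≤ p k := by exact_mod_cast hp k
  have hN : 0 < (n k : ℝ) * p k := by positivity
  have hlogp1 : 1 ≤ Real.log (p k) := by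
    rw [Real.le_log_iff_exp_le (by linarith)]
    linarith [Real.exp_one_lt_three]
  have hlogp : Real.log (p k) ≤ Real.log ((n k : ℝ) * p k) :=
    Real.log_le_log (by linarith) (by nlinarith)
  have hlogn : Real.log 2 ≤ Real.log (n k) := Real.log_le_log two_pos hn'
  set r := Real.sqrt (Real.log (p k) / ((n k : ℝ) * p k)) with hr
  have hr2 : r ^ 2 = Real.log (p k) / ((n k : ℝ) * p k) := Real.sq_sqrt (by positivity)
  have hrN : r ≤ Real.sqrt (Real.log ((n k : ℝ) * p k)
      * Real.exp (-Real.log ((n k : ℝ) * p k))) := by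
    rw [Real.exp_neg, Real.exp_log hN, ← div_eq_mul_inv]
    exact Real.sqrt_le_sqrt (by gcongr)
  -- The factor `exp (2 κ₁)` offsets `exp (4 κ₁)` in the tail bound and raises `4 κ₁` to `6 κ₁` in
  -- the error.
  set s := Real.exp (2 * ‖θ k 1‖) * (S * r) with hs
  have hs0 : 0 ≤ s := by positivity
  have herr : 8320 * Real.exp (10 * ‖θ k 0‖ + 4 * ‖θ k 1‖ + 7) * s
      = D * (Real.exp (10 * ‖θ k 0‖ + 6 * ‖θ k 1‖) * r) := by
    have : Real.exp (10 * ‖θ k 0‖ + 6 * ‖θ k 1‖)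
        = Real.exp (10 * ‖θ k 0‖ + 4 * ‖θ k 1‖) * Real.exp (2 * ‖θ k 1‖) := by
      rw [← Real.exp_add]; congr 1; ring
    rw [hs, hD, this, Real.exp_add _ 7]
    ring
  have hsm : 8320 * Real.exp (10 * ‖θ k 0‖ + 4 * ‖θ k 1‖ + 7) * s < 1 / 2 := by
    rw [herr]
    refine lt_of_le_of_lt ?_ hk
    -- With `κ₀ + κ₁ ≤ log (np) / 40` the exponential costs at most `(np) ^ (1/4)`, which `√(log
    -- (np) / (np))` beats.
    have : 10 * ‖θ k 0‖ + 6 * ‖θ k 1‖ ≤ Real.log ((n k : ℝ) * p k) / 4 := by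
      linarith [hθ k, norm_nonneg (θ k 1)]
    simp only [Function.comp_apply]
    gcongr
  refine (measure_mono ?_).trans
    (((hX k).measure_not_exists_isMME_le (hp k) (by linarith [hn k]) hs0 hsm).trans
      (ENNReal.ofReal_le_ofReal ?_))
  · intro ω hω hex
    refine hω (hex.imp fun η hη => ⟨hη.1, hη.2.trans ?_⟩)
    -- The argument gives the rate without `log n`; that factor is at least `log 2`, since `n ≥ 2`.
    have hrate : r ≤ Real.sqrt (Real.log (n k) * Real.log (p k) / ((n k : ℝ) * p k))
        / Real.sqrt (Real.log 2) := by
      rw [le_div_iff₀ (Real.sqrt_pos.2 hlog2), hr, ← Real.sqrt_mul (by positivity)]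
      refine Real.sqrt_le_sqrt ?_
      rw [div_mul_eq_mul_div, mul_comm]
      gcongr
    rw [herr]
    calc D * (Real.exp (10 * ‖θ k 0‖ + 6 * ‖θ k 1‖) * r)
        ≤ D * (Real.exp (14 * ‖θ k 0‖ + 6 * ‖θ k 1‖) *
          (Real.sqrt (Real.log (n k) * Real.log (p k) / ((n k : ℝ) * p k))
            / Real.sqrt (Real.log 2))) := by
          gcongr
          norm_num
      _ = _ := by ring
  · have hexponent : -(2 * ((n k : ℝ) * (p k - 1) * s ^ 2)) / (81 * Real.exp (4 * ‖θ k 1‖))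
        ≤ -((1 + a) * Real.log (p k)) := by
      have hexp : Real.exp (4 * ‖θ k 1‖) = Real.exp (2 * ‖θ k 1‖) ^ 2 := by
        rw [← Real.exp_nat_mul]; congr 1; push_cast; ring
      have heq : -(2 * ((n k : ℝ) * (p k - 1) * s ^ 2)) / (81 * Real.exp (4 * ‖θ k 1‖))
          = -((1 + a) * Real.log (p k)) * (3 / 2 * ((p k - 1) / p k)) := by
        have hp0 : (p k : ℝ) ≠ 0 := by positivity
        have hn0 : (n k : ℝ) ≠ 0 := by positivity
        rw [hs, mul_pow, mul_pow, hS2, hr2, hexp]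
        field_simp
        ring
      have hge : 1 ≤ 3 / 2 * (((p k : ℝ) - 1) / p k) := by
        rw [← mul_div_assoc, one_le_div (by positivity)]
        linarith
      rw [heq]
      have : 0 ≤ (1 + a) * Real.log (p k) := by positivity
      nlinarith
    calc 4 * (p k : ℝ) * Real.exp (-(2 * ((n k : ℝ) * (p k - 1) * s ^ 2))
            / (81 * Real.exp (4 * ‖θ k 1‖)))
        ≤ 4 * (p k : ℝ) * Real.exp (-((1 + a) * Real.log (p k))) := by gcongr
      _ = 4 * Real.exp (-(a * Real.log (p k))) := by
        nth_rewrite 1 [← Real.exp_log (show (0 : ℝ) < p k by linarith)]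
        rw [mul_assoc, ← Real.exp_add]
        congr 2
        ring
      _ ≤ 4 * Real.exp (-Real.log (4 / δ)) := by
        have h1 : Real.log (4 / δ) ≤ a := le_max_right _ _
        have h2 : a ≤ a * Real.log (p k) := le_mul_of_one_le_right ha0 hlogp1
        gcongr
        linarith
      _ = δ := by
        rw [Real.exp_neg, Real.exp_log (by positivity)]
        field_simp

/-- Events whose complements have eventually small (outer) measure have probability tending to
one. -/
lemma tendsto_measure_one_of_compl_le {Ω : ℕ → Type*} [∀ k, MeasurableSpace (Ω k)]
    {μ : ∀ k, Measure (Ω k)} [∀ k, IsProbabilityMeasure (μ k)] {A : ∀ k, Set (Ω k)}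
    (h : ∀ δ : ℝ, 0 < δ → ∀ᶠ k in atTop, μ k (A k)ᶜ ≤ ENNReal.ofReal δ) :
    Tendsto (fun k => μ k (A k)) atTop (𝓝 1) := by
  have h0 : Tendsto (fun k => μ k (A k)ᶜ) atTop (𝓝 0) := by
    rw [ENNReal.tendsto_nhds_zero]
    intro e he
    obtain ⟨δ, hδ, hδe⟩ := ENNReal.lt_iff_exists_real_btwn.1 he
    have hδ0 : 0 < δ := by
      simpa using hδe.1
    filter_upwards [h δ hδ0] with k hk using hk.trans hδe.2.le
  have h1 : Tendsto (fun k => 1 - μ k (A k)ᶜ) atTop (𝓝 (1 - 0)) :=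
    ENNReal.Tendsto.sub tendsto_const_nhds h0 (Or.inl ENNReal.one_ne_top)
  rw [tsub_zero] at h1
  refine tendsto_of_tendsto_of_tendsto_of_le_of_le h1 tendsto_const_nhds (fun k => ?_)
    fun k => prob_le_one
  rw [tsub_le_iff_right, ← measure_univ (μ := μ k), ← Set.union_compl_self (A k)]
  exact measure_union_le _ _

theorem theorem4 :
    ∃ c : ℝ, 0 < c ∧
      ∀ (K : ℝ) (n p : ℕ → ℕ) (Ω : ℕ → Type*) [∀ k, MeasurableSpace (Ω k)]
        (μ : ∀ k, Measure (Ω k)) [∀ k, IsProbabilityMeasure (μ k)]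
        (θ : ∀ k, TWHMParam (p k))
        (X ε : ∀ k, ℕ → Fin (p k) → Fin (p k) → Ω k → ℤ)
        (est : ∀ k, Ω k → TWHMParam (p k)),
        (∀ k, 2 ≤ n k) → (∀ k, 3 ≤ p k) →
        Tendsto (fun k => n k * p k) atTop atTop →
        (∀ k i, θ k 1 i - max (θ k 0 i) 0 < K) →
        (∀ k, IsStationaryTWHM (μ k) (θ k) (X k) (ε k)) →
        (∀ k, IsMMEstimator (n k) (X k) (est k)) →
        -- uniqueness
        (∀ k ω (η η' : TWHMParam (p k)), IsMME (n k) (fun t i j => X k t i j ω) η →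
          IsMME (n k) (fun t i j => X k t i j ω) η' → η = η') ∧
        -- existence and rate
        ((∀ k, ‖θ k 0‖ + ‖θ k 1‖ ≤ c * Real.log ((n k : ℝ) * (p k : ℝ))) →
          Tendsto (fun k => μ k {ω | ∃! η : TWHMParam (p k),
            IsMME (n k) (fun t i j => X k t i j ω) η}) atTop (𝓝 1) ∧
          IsBigOInProb μ (fun k ω => ‖est k ω - θ k‖)
            (fun k => Real.exp (14 * ‖θ k 0‖ + 6 * ‖θ k 1‖) *
              Real.sqrt (Real.log (n k) * Real.log (p k) / ((n k : ℝ) * (p k : ℝ))))) := by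
  refine ⟨1 / 40, by norm_num, ?_⟩
  intro K n p Ω _ μ _ θ X ε est hn hp hnp _ hX hest
  have huniq : ∀ k ω (η η' : TWHMParam (p k)), IsMME (n k) (fun t i j => X k t i j ω) η →
      IsMME (n k) (fun t i j => X k t i j ω) η' → η = η' := fun k ω η η' h h' =>
    h.unique (hp k) (by have := hn k; omega) h'
  refine ⟨huniq, fun hθ => ⟨tendsto_measure_one_of_compl_le fun δ hδ => ?_, fun δ hδ => ?_⟩⟩
  · obtain ⟨C, -, hC⟩ := exists_eventually_measure_le hn hp hnp hX hθ hδ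
    filter_upwards [hC] with k hk
    refine (measure_mono ?_).trans hk
    intro ω hω hex
    obtain ⟨η, hη, -⟩ := hex
    exact hω ⟨η, hη, fun η' hη' => huniq k ω _ _ hη' hη⟩
  · obtain ⟨C, hC0, hC⟩ := exists_eventually_measure_le hn hp hnp hX hθ hδ
    refine ⟨C, hC0, ?_⟩
    filter_upwards [hC] with k hk
    refine (measure_mono ?_).trans hk
    intro ω hω hex
    obtain ⟨η, hη, hle⟩ := hex
    -- Where a nearby solution exists, uniqueness makes it the value of the estimator.
    have heq : est k ω = η := huniq k ω _ _ (hest k ω ⟨η, hη⟩) hη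
    rw [← heq] at hle
    have hlt : _ < |‖est k ω - θ k‖| := hω
    rw [abs_of_nonneg (norm_nonneg _)] at hlt
    exact absurd hle (not_le.2 hlt)
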